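/- **Conventions.** All Banach spaces are complex; $B_X$ is the closed unit ball of $X$. A weight on an open subset $U$ of a Banach space $E$ is a continuous function $v\colon U\to(0,\infty)$. For a Banach space $F$, $\mathcal H^\infty_v(U,F)$ is the space of holomorphic $f\colon U\to F$ with $\|f\|_v:=\sup_{x\in U}v(x)\|f(x)\|<\infty$ (suprema of non-negative quantities over the empty set are $0$), and $\mathcal H^\infty_v(U):=\mathcal H^\infty_v(U,\mathbb C)$. Let $p\in[1,\infty]$, and let $p^*$ be its conjugate exponent. For a sequence $(x_n)$ in $X$ let $\|(x_n)\|_p=(\sum_n\|x_n\|^p)^{1/p}$ if $p<\infty$, $\|(x_n)\|_\infty=\sup_n\|x_n\|$, and $\|(x_n)\|_p^w=\sup_{x^*\in B_{X^*}}\|(x^*(x_n))\|_p$. For $p<\infty$ let $\ell_p(X)$ (resp. $\ell_p^w(X)$) be the space of sequences with $\|(x_n)\|_p<\infty$ (resp. $\|(x_n)\|_p^w<\infty$), and $\ell_p^u(X)$ the space of $(x_n)\in\ell_p^w(X)$ with $\|(x_n)_{n\ge m}\|_p^w\to0$ as $m\to\infty$; let $c_0(X)$ and $c_0^w(X)$ be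 the spaces of norm null and of weakly null sequences. Let $p\text{-}\mathrm{conv}(x_n)=\{\sum_n a_nx_n : (a_n)\in B\}$, where $B=B_{\ell_{p^*}}$ if $1<p<\infty$, $B=B_{c_0}$ if $p=1$, and $B=B_{\ell_1}$ if $p=\infty$. A set $K\subseteq X$ is relatively $p$-compact (resp. relatively weakly $p$-compact, relatively unconditionally $p$-compact) if $K\subseteq p\text{-}\mathrm{conv}(x_n)$ for some $(x_n)$ in $\ell_p(X)$ (resp. $\ell_p^w(X)$, $\ell_p^u(X)$) when $p<\infty$, or in $c_0(X)$ (resp. $c_0^w(X)$, $c_0(X)$) when $p=\infty$. Let $m_{\mathcal K_p}(K)$ (resp. $m_{\mathcal K_{wp}}(K)$, $m_{\mathcal K_{up}}(K)$) be the infimum, over all such $(x_n)$, of $\|(x_n)\|_p$ (resp. $\|(x_n)\|_p^w$, $\|(x_n)\|_p^w$) when $p<\infty$, and of $\|(x_n)\|_\infty$ when $p=\infty$. For $\mathcal I=\mathcal K_p,\mathcal K_{wp},\mathcal K_{up}$, let $\mathcal I(X,Y)$ be the set of bounded linear operators $T\colon X\to Y$ such that $T(B_X)$ is relatively $p$-compact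 (resp. relatively weakly, relatively unconditionally $p$-compact), with $\|T\|_{\mathcal I}=m_{\mathcal I}(T(B_X))$. Let $\mathcal H^\infty_{v\mathcal I}(U,F)$ be the set of all $f\in\mathcal H^\infty_v(U,F)$ such that $(vf)(U)=\{v(x)f(x):x\in U\}$ is relatively $p$-compact (resp. relatively weakly, relatively unconditionally $p$-compact), with $\|f\|_{\mathcal H^\infty_{v\mathcal I}}=m_{\mathcal I}((vf)(U))$. Let $\mathcal I\circ\mathcal H^\infty_v(U,F)$ be the set of all $f\in\mathcal H^\infty_v(U,F)$ of the form $f=T\circ g$ for some Banach space $G$, $T\in\mathcal I(G,F)$ and $g\in\mathcal H^\infty_v(U,G)$, with $\|f\|_{\mathcal I\circ\mathcal H^\infty_v}=\inf\|T\|_{\mathcal I}\|g\|_v$ over all such factorizations. **Statement.** Let $p\in[1,\infty]$ and let $\mathcal I$ be one of $\mathcal K_p,\mathcal K_{wp},\mathcal K_{up}$. (a) For all Banach spaces $E,F$, every open $U\subseteq E$ and every weight $v$ on $U$, $$\mathcal H^\infty_{v\mathcal I}(U,F)=\mathcal I\circ\mathcal H^\infty_v(U,F)\quad\text{and}\quad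 \|f\|_{\mathcal H^\infty_{v\mathcal I}}=\|f\|_{\mathcal I\circ\mathcal H^\infty_v}\ \text{ for every } f\in\mathcal H^\infty_{v\mathcal I}(U,F).$$ (b) $[\mathcal H^\infty_{v\mathcal I},\|\cdot\|_{\mathcal H^\infty_{v\mathcal I}}]$ is a Banach ideal of weighted holomorphic mappings, that is, for all $E,F,U,v$ as in (a): 1. $\mathcal H^\infty_{v\mathcal I}(U,F)$ is a linear subspace of $\mathcal H^\infty_v(U,F)$, it is a Banach space under $\|\cdot\|_{\mathcal H^\infty_{v\mathcal I}}$, and $\|f\|_v\le\|f\|_{\mathcal H^\infty_{v\mathcal I}}$ for each of its elements $f$. 2. For $h\in\mathcal H^\infty_v(U)$ and $y\in F$, the map $h\cdot y\colon x\mapsto h(x)y$ belongs to $\mathcal H^\infty_{v\mathcal I}(U,F)$ and $\|h\cdot y\|_{\mathcal H^\infty_{v\mathcal I}}=\|h\|_v\|y\|$. 3. If $V\subseteq U$ is open, $h\colon V\to U$ is holomorphic with $c_v(h):=\sup_{x\in V}v(x)/v(h(x))<\infty$, $f\in\mathcal H^\infty_{v\mathcal I}(U,F)$, and $S\colon F\to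 G_0$ is a bounded linear operator into a Banach space $G_0$, then $S\circ f\circ h\in\mathcal H^\infty_{v\mathcal I}(V,G_0)$ (with respect to the restriction of $v$ to $V$) and $\|S\circ f\circ h\|_{\mathcal H^\infty_{v\mathcal I}}\le\|S\|\,\|f\|_{\mathcal H^\infty_{v\mathcal I}}\,c_v(h)$. -/

import Mathlib

open Filter Topology TopologicalSpace
open scoped ENNReal

universe u w

namespace WeightedHol

noncomputable section

/-! ### Sequence spaces, `p`-convex hulls and the three kinds of `p`-compact sets -/

section Sequences

variable {X : Type u} [NormedAddCommGroup X] [NormedSpace ℂ X]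

/-- The norm `‖(xₙ)‖_p` of a sequence, with value `∞` if the sequence is not in `ℓ_p`:
`(∑ ‖xₙ‖ ^ p) ^ (1 / p)` for finite `p`, and `sup ‖xₙ‖` for `p = ∞`. -/
def seqNorm {Y : Type*} [NormedAddCommGroup Y] (p : ℝ≥0∞) (x : ℕ → Y) : ℝ≥0∞ :=
  if p = ∞ then ⨆ n, ‖x n‖ₑ else (∑' n, ‖x n‖ₑ ^ p.toReal) ^ (1 / p.toReal)

/-- The weak norm `sup {‖(φ (xₙ))‖_p : φ in the closed unit ball of the dual}`. -/
def weakSeqNorm (p : ℝ≥0∞) (x : ℕ → X) : ℝ≥0∞ :=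
  ⨆ φ : StrongDual ℂ X, ⨆ _ : ‖φ‖ ≤ 1, seqNorm p (fun n => φ (x n))

/-- The three kinds of compactness: `p`-compact (`strong`), weakly `p`-compact (`weak`),
unconditionally `p`-compact (`uncond`). -/
inductive Kind
  | strong
  | weak
  | uncond

/-- The generating sequences: for finite `p` the spaces `ℓ_p(X)`, `ℓ_p^w(X)`, `ℓ_p^u(X)`;
for `p = ∞` the spaces `c₀(X)`, `c₀^w(X)`, `c₀(X)`. -/
def IsGenerating (p : ℝ≥0∞) (x : ℕ → X) : Kind → Prop
  | .strong => if p = ∞ then Tendsto x atTop (𝓝 0) else seqNorm p x < ∞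
  | .weak =>
      if p = ∞ then ∀ φ : StrongDual ℂ X, Tendsto (fun n => φ (x n)) atTop (𝓝 0)
      else weakSeqNorm p x < ∞
  | .uncond =>
      if p = ∞ then Tendsto x atTop (𝓝 0)
      else weakSeqNorm p x < ∞ ∧
        Tendsto (fun m : ℕ => weakSeqNorm p (fun n => x (n + m))) atTop (𝓝 0)

/-- The norm of a generating sequence: `‖·‖_p` or `‖·‖_p^w` for finite `p`, and the supremum norm
for `p = ∞`. -/
def genNorm (p : ℝ≥0∞) (x : ℕ → X) : Kind → ℝ≥0∞
  | .strong => seqNorm p x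
  | .weak => if p = ∞ then seqNorm ∞ x else weakSeqNorm p x
  | .uncond => if p = ∞ then seqNorm ∞ x else weakSeqNorm p x

/-- The coefficient sequences: the closed unit ball of `ℓ_{p*}`, where `1/p + 1/p* = 1`
(so `ℓ_1` if `p = ∞`), and the closed unit ball of `c₀` if `p = 1`. -/
def coefBall (p : ℝ≥0∞) : Set (ℕ → ℂ) :=
  {a | seqNorm p.conjExponent a ≤ 1 ∧ (p = 1 → Tendsto a atTop (𝓝 0))}

/-- The `p`-convex hull of a sequence. -/
def pConv (p : ℝ≥0∞) (x : ℕ → X) : Set X :=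
  {y | ∃ a ∈ coefBall p, HasSum (fun n => a n • x n) y}

/-- Relatively `p`-compact, relatively weakly `p`-compact, and relatively unconditionally
`p`-compact sets. -/
def IsRelCompact (i : Kind) (p : ℝ≥0∞) (K : Set X) : Prop :=
  ∃ x : ℕ → X, IsGenerating p x i ∧ K ⊆ pConv p x

/-- The measure `m(K)` of the size of the `p`-compactness of `K`
(equal to `∞` if there is no suitable sequence). -/
def compactSize (i : Kind) (p : ℝ≥0∞) (K : Set X) : ℝ≥0∞ :=
  ⨅ x : ℕ → X, ⨅ _ : IsGenerating p x i ∧ K ⊆ pConv p x, genNorm p x i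

end Sequences

/-! ### Operators -/

/-- An assignment of a set of bounded operators between complex Banach spaces, together with a
real-valued function on these operators (only its values on the set are meaningful). -/
structure OperatorClass : Type (u + 1) where
  mem : ∀ (X Y : Type u) [NormedAddCommGroup X] [NormedSpace ℂ X] [CompleteSpace X]
    [NormedAddCommGroup Y] [NormedSpace ℂ Y] [CompleteSpace Y], Set (X →L[ℂ] Y)
  norm : ∀ {X Y : Type u} [NormedAddCommGroup X] [NormedSpace ℂ X] [CompleteSpace X]
    [NormedAddCommGroup Y] [NormedSpace ℂ Y] [CompleteSpace Y], (X →L[ℂ] Y) → ℝ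

/-- The classes `𝒦_p`, `𝒦_{wp}`, `𝒦_{up}` of `p`-compact, weakly `p`-compact and unconditionally
`p`-compact operators `T`, with the norm `m(T(B_X))`. -/
def compactOperators (i : Kind) (p : ℝ≥0∞) : OperatorClass.{u} where
  mem X Y _ _ _ _ _ _ := {T : X →L[ℂ] Y | IsRelCompact i p (T '' Metric.closedBall (0 : X) 1)}
  norm {X} {_} _ _ _ _ _ _ T := (compactSize i p (T '' Metric.closedBall (0 : X) 1)).toReal

/-! ### Weighted holomorphic mappings -/

/-- A weight on `U`: a strictly positive continuous function on `U`. -/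
structure Weight {E : Type u} [NormedAddCommGroup E] (U : Opens E) where
  toFun : U → ℝ
  continuous_toFun : Continuous toFun
  pos : ∀ x, 0 < toFun x

/-- The restriction of a weight to a smaller open set. -/
def Weight.restrict {E : Type u} [NormedAddCommGroup E] {U V : Opens E} (v : Weight U)
    (hVU : V ≤ U) : Weight V where
  toFun x := v.toFun ⟨x, hVU x.2⟩
  continuous_toFun := v.continuous_toFun.comp (by fun_prop)
  pos x := v.pos _

section Maps

variable {E : Type u} {F : Type w} [NormedAddCommGroup E] [NormedSpace ℂ E]
  [NormedAddCommGroup F] [NormedSpace ℂ F] {U : Opens E}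

/-- Holomorphic mappings on the open set `U`: complex (Fréchet) differentiable at each point. -/
def IsHolomorphic (f : U → F) : Prop :=
  ∃ g : E → F, DifferentiableOn ℂ g (U : Set E) ∧ ∀ x : U, g x = f x

/-- The weighted supremum norm `‖f‖_v`. -/
def wNorm (v : Weight U) (f : U → F) : ℝ := ⨆ x : U, v.toFun x * ‖f x‖

/-- The space `H_v^∞(U, F)` of weighted holomorphic mappings. -/
def weightedHol (v : Weight U) (F : Type w) [NormedAddCommGroup F] [NormedSpace ℂ F] :
    Set (U → F) :=
  {f | IsHolomorphic f ∧ BddAbove (Set.range fun x : U => v.toFun x * ‖f x‖)}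

/-- The `v`-range `(vf)(U)`. -/
def vRange (v : Weight U) (f : U → F) : Set F :=
  Set.range fun x : U => (v.toFun x : ℂ) • f x

end Maps

/-- An assignment that associates with every weight `v` on an open subset `U` of a complex Banach
space and every complex Banach space `F` a set of mappings from `U` to `F`, together with a
real-valued function on these mappings (only its values on the set are meaningful). -/
structure HolClass : Type (u + 1) where
  mem : ∀ {E : Type u} [NormedAddCommGroup E] [NormedSpace ℂ E] [CompleteSpace E]
    {U : Opens E} (_v : Weight U)
    (F : Type u) [NormedAddCommGroup F] [NormedSpace ℂ F] [CompleteSpace F], Set (U → F)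
  norm : ∀ {E : Type u} [NormedAddCommGroup E] [NormedSpace ℂ E] [CompleteSpace E]
    {U : Opens E} (_v : Weight U)
    {F : Type u} [NormedAddCommGroup F] [NormedSpace ℂ F] [CompleteSpace F], (U → F) → ℝ

/-- The class of all `f` in `H_v^∞(U, F)` whose `v`-range is relatively (weakly, unconditionally)
`p`-compact, with the norm `m((vf)(U))`. -/
def compactRangeClass (i : Kind) (p : ℝ≥0∞) : HolClass.{u} where
  mem {_} _ _ _ {_} v F _ _ _ := {f | f ∈ weightedHol v F ∧ IsRelCompact i p (vRange v f)}
  norm {_} _ _ _ {_} v {_} _ _ _ f := (compactSize i p (vRange v f)).toReal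

/-- The composition class of an operator class `I` with the weighted holomorphic mappings: all
`f = T ∘ g` with `g` in `H_v^∞(U, G)` and `T` in `I(G, F)` for some complex Banach space `G`;
its norm is the infimum of `‖T‖_I * ‖g‖_v` over all such factorizations. -/
def compositionClass (I : OperatorClass.{u}) : HolClass.{u} where
  mem {_} _ _ _ {U} v F _ _ _ := {f | f ∈ weightedHol v F ∧
    ∃ (G : Type u) (_ : NormedAddCommGroup G) (_ : NormedSpace ℂ G) (_ : CompleteSpace G)
      (T : G →L[ℂ] F) (g : U → G),
      T ∈ I.mem G F ∧ g ∈ weightedHol v G ∧ ∀ x, f x = T (g x)}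
  norm {_} _ _ _ {U} v {F} _ _ _ f := sInf {r : ℝ |
    ∃ (G : Type u) (_ : NormedAddCommGroup G) (_ : NormedSpace ℂ G) (_ : CompleteSpace G)
      (T : G →L[ℂ] F) (g : U → G),
      T ∈ I.mem G F ∧ g ∈ weightedHol v G ∧ (∀ x, f x = T (g x)) ∧ r = I.norm T * wNorm v g}

/-- Two classes coincide isometrically: they have the same members, with the same norms. -/
def HolClass.IsometricallyEqual (A B : HolClass.{u}) : Prop :=
  ∀ {E : Type u} [NormedAddCommGroup E] [NormedSpace ℂ E] [CompleteSpace E]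
    {U : Opens E} (v : Weight U)
    (F : Type u) [NormedAddCommGroup F] [NormedSpace ℂ F] [CompleteSpace F],
    A.mem v F = B.mem v F ∧ ∀ f ∈ A.mem v F, A.norm v f = B.norm v f

/-- `S` is a linear subspace of `W` on which `N` is a complete norm. -/
structure IsBanachSubspace {W : Type u} [AddCommGroup W] [Module ℂ W] (S : Set W) (N : W → ℝ) :
    Prop where
  zero_mem : 0 ∈ S
  add_mem : ∀ f ∈ S, ∀ g ∈ S, f + g ∈ S
  smul_mem : ∀ (c : ℂ), ∀ f ∈ S, c • f ∈ S
  norm_nonneg : ∀ f ∈ S, 0 ≤ N f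
  norm_eq_zero_iff : ∀ f ∈ S, (N f = 0 ↔ f = 0)
  norm_smul : ∀ (c : ℂ), ∀ f ∈ S, N (c • f) = ‖c‖ * N f
  norm_add_le : ∀ f ∈ S, ∀ g ∈ S, N (f + g) ≤ N f + N g
  complete : ∀ s : ℕ → W, (∀ n, s n ∈ S) →
    (∀ ε > 0, ∃ n₀, ∀ m ≥ n₀, ∀ n ≥ n₀, N (s m - s n) < ε) →
    ∃ f ∈ S, Tendsto (fun n => N (s n - f)) atTop (𝓝 0)

/-- Banach ideals of weighted holomorphic mappings. -/
structure HolClass.IsBanachIdeal (A : HolClass.{u}) : Prop where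
  subset_weightedHol : ∀ {E : Type u} [NormedAddCommGroup E] [NormedSpace ℂ E] [CompleteSpace E]
    {U : Opens E} (v : Weight U)
    (F : Type u) [NormedAddCommGroup F] [NormedSpace ℂ F] [CompleteSpace F],
    A.mem v F ⊆ weightedHol v F
  /-- The components are Banach spaces. -/
  isBanach : ∀ {E : Type u} [NormedAddCommGroup E] [NormedSpace ℂ E] [CompleteSpace E]
    {U : Opens E} (v : Weight U)
    (F : Type u) [NormedAddCommGroup F] [NormedSpace ℂ F] [CompleteSpace F],
    IsBanachSubspace (A.mem v F) (A.norm v)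
  wNorm_le : ∀ {E : Type u} [NormedAddCommGroup E] [NormedSpace ℂ E] [CompleteSpace E]
    {U : Opens E} (v : Weight U)
    (F : Type u) [NormedAddCommGroup F] [NormedSpace ℂ F] [CompleteSpace F],
    ∀ f ∈ A.mem v F, wNorm v f ≤ A.norm v f
  /-- The mappings `h · y` belong to the class, with norm `‖h‖_v * ‖y‖`. -/
  smul_const : ∀ {E : Type u} [NormedAddCommGroup E] [NormedSpace ℂ E] [CompleteSpace E]
    {U : Opens E} (v : Weight U)
    (F : Type u) [NormedAddCommGroup F] [NormedSpace ℂ F] [CompleteSpace F],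
    ∀ h ∈ weightedHol v ℂ, ∀ y : F,
    (fun x : U => h x • y) ∈ A.mem v F ∧
      A.norm v (fun x : U => h x • y) = wNorm v h * ‖y‖
  /-- The ideal property. -/
  ideal : ∀ {E : Type u} [NormedAddCommGroup E] [NormedSpace ℂ E] [CompleteSpace E]
    {U V : Opens E} (v : Weight U) (hVU : V ≤ U)
    (F G₀ : Type u) [NormedAddCommGroup F] [NormedSpace ℂ F] [CompleteSpace F]
    [NormedAddCommGroup G₀] [NormedSpace ℂ G₀] [CompleteSpace G₀]
    (h : V → U) (f : U → F) (S : F →L[ℂ] G₀),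
    IsHolomorphic (fun x : V => (h x : E)) →
    BddAbove (Set.range fun x : V => (v.restrict hVU).toFun x / v.toFun (h x)) →
    f ∈ A.mem v F →
    (fun x : V => S (f (h x))) ∈ A.mem (v.restrict hVU) G₀ ∧
      A.norm (v.restrict hVU) (fun x : V => S (f (h x))) ≤
        ‖S‖ * A.norm v f * ⨆ x : V, (v.restrict hVU).toFun x / v.toFun (h x)

end

end WeightedHol

/-! One scheme serves all three kinds of compactness, because each generating norm dominates the
weak norm. Convergence of `∑ a n • x n` needs only a finite weak norm, Hölder's inequality and small
tails of the coefficients (`summable_smul`).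

For the factorization, let `(vf)(U)` lie in the `p`-convex hull of `x`. The map `a ↦ ∑ a n • x n`
acts on `ℓ_{p*}` (on `c₀` if `p = 1`). Dividing by its kernel gives a separable Banach space `G` and
an injective `T : G → F` whose unit ball image is the hull, up to a factor `1 + ε`
(`exists_injective_operator_pConv`). Hence `f = T ∘ g` with `‖g‖_v ≤ 1`. The remaining question is
why `g` is holomorphic, since `T` has no bounded inverse. By Lusin–Souslin an injective continuous
map on a Polish space reflects measurability, so the locally bounded `g` can be integrated over
circles. The operator `T` maps Cauchy integrals of `g` to those of `f`, and injectivity transfers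
Cauchy's formula, a quadratic Taylor remainder and linearity of the derivative back to `g`
(`differentiableAt_of_injective`). Conversely, if `f = T ∘ g`, then `(vf)(U)` lies in `‖g‖_v •
T(B_G)`.

The Banach space structure comes from interleaving generating sequences: rows are scaled by `c k`
and their coefficients by `(c k)⁻¹`. Hölder-optimal weights give the exact triangle inequality
(`exists_generating_add`), and the weights `2 ^ (k + 1)` sum a rapidly decreasing telescoping series
(`exists_generating_tsum`), which gives completeness. The ideal properties reduce to
`IsRelCompact.of_forall_exists_smul`. -/

namespace WeightedHol

noncomputable section

/-! ### The `ℓ_p` norm of a family in `[0, ∞]` -/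

section LpE

variable {ι κ : Type*}

/-- The `ℓ_p` norm of a family in `[0, ∞]`. -/
def lpE (p : ℝ≥0∞) (s : ι → ℝ≥0∞) : ℝ≥0∞ :=
  if p = ∞ then ⨆ n, s n else (∑' n, s n ^ p.toReal) ^ (1 / p.toReal)

theorem seqNorm_eq_lpE {Y : Type*} [NormedAddCommGroup Y] (p : ℝ≥0∞) (x : ℕ → Y) :
    seqNorm p x = lpE p (fun n => ‖x n‖ₑ) := rfl

theorem lpE_top (s : ι → ℝ≥0∞) : lpE ∞ s = ⨆ n, s n := if_pos rfl

theorem lpE_of_ne_top {p : ℝ≥0∞} (hp : p ≠ ∞) (s : ι → ℝ≥0∞) :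
    lpE p s = (∑' n, s n ^ p.toReal) ^ (1 / p.toReal) := if_neg hp

theorem toReal_pos_of_one_le {p : ℝ≥0∞} (h1 : 1 ≤ p) (hp : p ≠ ∞) : 0 < p.toReal :=
  ENNReal.toReal_pos (zero_lt_one.trans_le h1).ne' hp

theorem lpE_rpow {p : ℝ≥0∞} (h1 : 1 ≤ p) (hp : p ≠ ∞) (s : ι → ℝ≥0∞) :
    lpE p s ^ p.toReal = ∑' n, s n ^ p.toReal := by
  rw [lpE_of_ne_top hp, ← ENNReal.rpow_mul, one_div,
    inv_mul_cancel₀ (toReal_pos_of_one_le h1 hp).ne', ENNReal.rpow_one]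

theorem lpE_mono (p : ℝ≥0∞) {s t : ι → ℝ≥0∞} (h : ∀ n, s n ≤ t n) : lpE p s ≤ lpE p t := by
  unfold lpE
  split_ifs
  · exact iSup_mono h
  · gcongr with n
    exact h n

theorem lpE_one (s : ι → ℝ≥0∞) : lpE 1 s = ∑' n, s n := by
  simp [lpE]

theorem lpE_const_mul {p : ℝ≥0∞} (h1 : 1 ≤ p) (c : ℝ≥0∞) (s : ι → ℝ≥0∞) :
    lpE p (fun n => c * s n) = c * lpE p s := by
  by_cases hp : p = ∞
  · subst hp
    simp [lpE_top, ENNReal.mul_iSup]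
  · have h0 := toReal_pos_of_one_le h1 hp
    rw [lpE_of_ne_top hp, lpE_of_ne_top hp]
    simp_rw [ENNReal.mul_rpow_of_nonneg _ _ h0.le]
    rw [ENNReal.tsum_mul_left, ENNReal.mul_rpow_of_nonneg _ _ (by positivity), ← ENNReal.rpow_mul,
      mul_one_div_cancel h0.ne', ENNReal.rpow_one]

theorem lpE_comp_equiv (p : ℝ≥0∞) (e : κ ≃ ι) (s : ι → ℝ≥0∞) :
    lpE p (fun k => s (e k)) = lpE p s := by
  unfold lpE
  rw [e.iSup_comp (g := s), e.tsum_eq (fun n => s n ^ p.toReal)]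

theorem lpE_comp_le_of_injective (p : ℝ≥0∞) {f : κ → ι} (hf : f.Injective) (s : ι → ℝ≥0∞) :
    lpE p (fun k => s (f k)) ≤ lpE p s := by
  unfold lpE
  split_ifs
  · exact iSup_comp_le s f
  · gcongr
    exact ENNReal.tsum_comp_le_tsum_of_injective hf (fun n => s n ^ p.toReal)

theorem lpE_prod {p : ℝ≥0∞} (h1 : 1 ≤ p) (s : κ → ι → ℝ≥0∞) :
    lpE p (fun q : κ × ι => s q.1 q.2) = lpE p (fun k => lpE p (s k)) := by
  by_cases hp : p = ∞
  · subst hp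
    simp only [lpE_top, iSup_prod]
  · rw [lpE_of_ne_top hp, lpE_of_ne_top hp]
    simp_rw [lpE_rpow h1 hp]
    rw [ENNReal.tsum_prod (f := fun k n => s k n ^ p.toReal)]

theorem le_lpE {p : ℝ≥0∞} (h1 : 1 ≤ p) (s : ι → ℝ≥0∞) (n : ι) : s n ≤ lpE p s := by
  by_cases hp : p = ∞
  · subst hp
    exact lpE_top s ▸ le_iSup s n
  · have h0 := toReal_pos_of_one_le h1 hp
    rw [← ENNReal.rpow_le_rpow_iff h0, lpE_rpow h1 hp]
    exact ENNReal.le_tsum (f := fun n => s n ^ p.toReal) n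

theorem lpE_le_tsum {p : ℝ≥0∞} (h1 : 1 ≤ p) (s : ι → ℝ≥0∞) : lpE p s ≤ ∑' n, s n := by
  by_cases hp : p = ∞
  · subst hp
    exact lpE_top s ▸ iSup_le fun n => ENNReal.le_tsum n
  · have h0 := toReal_pos_of_one_le h1 hp
    have h1' : 1 ≤ p.toReal := by
      simpa using ENNReal.toReal_mono hp h1
    rw [← ENNReal.rpow_le_rpow_iff h0, lpE_rpow h1 hp]
    -- Splitting off one factor allows `s n ^ (p - 1)` to be bounded by `(∑ s) ^ (p - 1)` in every
    -- term.
    have key : ∀ x : ℝ≥0∞, x ^ p.toReal = x * x ^ (p.toReal - 1) := fun x => by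
      nth_rewrite 2 [← ENNReal.rpow_one x]
      rw [← ENNReal.rpow_add_of_nonneg _ _ zero_le_one (by linarith)]
      congr 1
      ring
    rw [key (∑' n, s n), ← ENNReal.tsum_mul_right]
    refine ENNReal.tsum_le_tsum fun n => ?_
    rw [key]
    gcongr
    exact ENNReal.le_tsum n

theorem tsum_mul_le_lpE_mul_lpE {p : ℝ≥0∞} (h1 : 1 ≤ p) (s t : ι → ℝ≥0∞) :
    ∑' n, s n * t n ≤ lpE p.conjExponent s * lpE p t := by
  -- The endpoint pair `(1, ∞)` is isolated so that `p = ∞` follows from it by exchanging `s` and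
  -- `t`.
  have main : ∀ {p q : ℝ≥0∞}, q = p.conjExponent → p = 1 → ∀ s t : ι → ℝ≥0∞,
      ∑' n, s n * t n ≤ lpE q s * lpE p t := by
    rintro p q rfl rfl s t
    simp only [ENNReal.conjExponent, tsub_self, ENNReal.inv_zero, add_top, lpE_one,
      ← ENNReal.tsum_mul_left]
    exact ENNReal.tsum_le_tsum fun n => by gcongr; exact le_lpE le_top s n
  rcases h1.eq_or_lt with rfl | h1'
  · exact main rfl rfl s t
  by_cases hp : p = ∞
  · subst hp
    have := main (p := 1) (q := ∞) (by simp [ENNReal.conjExponent]) rfl t s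
    simpa [ENNReal.conjExponent, mul_comm] using this
  · lift p to NNReal using hp
    have h1'' : 1 < p := by exact_mod_cast h1'
    rw [← ENNReal.coe_conjExponent h1'', lpE_of_ne_top ENNReal.coe_ne_top,
      lpE_of_ne_top ENNReal.coe_ne_top, ENNReal.tsum_eq_iSup_sum]
    refine iSup_le fun S => ?_
    have hpq : (p : ℝ).HolderConjugate (NNReal.conjExponent p : ℝ) := by
      exact_mod_cast NNReal.HolderConjugate.conjExponent h1''
    refine (ENNReal.inner_le_Lp_mul_Lq S s t hpq.symm).trans ?_
    simp only [ENNReal.coe_toReal]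
    gcongr <;> exact ENNReal.sum_le_tsum _

end LpE

/-! ### Weak norms and convergence of `p`-convex combinations -/

section Sums

variable {X : Type u} [NormedAddCommGroup X] [NormedSpace ℂ X]
  {Y : Type w} [NormedAddCommGroup Y] [NormedSpace ℂ Y] {p : ℝ≥0∞}

/-- A convergent series has small tails, but a bounded family need not. For `q = ∞` the family must
therefore be null; this is why the coefficients are taken from `c₀` when `p = 1`. -/
theorem lpE_exists_tail {ι : Type*} {q : ℝ≥0∞} (hq : 1 ≤ q) {s : ι → ℝ≥0∞} (hs : lpE q s ≠ ∞)
    (h0 : q = ∞ → Tendsto s cofinite (𝓝 0)) {ε : ℝ≥0∞} (hε : 0 < ε) :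
    ∃ S : Finset ι, lpE q ((S : Set ι)ᶜ.indicator s) ≤ ε := by
  by_cases hqt : q = ∞
  · have hf : {n | ¬ s n < ε}.Finite :=
      eventually_cofinite.1 ((tendsto_order.1 (h0 hqt)).2 ε hε)
    subst hqt
    refine ⟨hf.toFinset, ?_⟩
    rw [lpE_top]
    refine iSup_le fun n => ?_
    by_cases hn : s n < ε
    · exact (Set.indicator_le_self' (fun _ _ => zero_le) n).trans hn.le
    · simp [hn]
  · have hp0 := toReal_pos_of_one_le hq hqt
    have hsum : ∑' n, s n ^ q.toReal ≠ ∞ := by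
      rw [← lpE_rpow hq hqt]
      exact ENNReal.rpow_ne_top_of_nonneg hp0.le hs
    obtain ⟨S, hS⟩ := ((tendsto_order.1 (ENNReal.tendsto_tsum_compl_atTop_zero hsum)).2
      (min (ε ^ q.toReal) 1) (lt_min (ENNReal.rpow_pos_of_nonneg hε hp0.le) one_pos)).exists
    refine ⟨S, ?_⟩
    rw [← ENNReal.rpow_le_rpow_iff hp0, lpE_rpow hq hqt]
    refine le_trans (le_of_eq ?_) (hS.le.trans (min_le_left _ _))
    rw [show (∑' b : { x // x ∉ S }, s b ^ q.toReal)
      = ∑' b : ((S : Set ι)ᶜ : Set ι), s b ^ q.toReal from rfl,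
      tsum_subtype (((S : Set ι)ᶜ : Set ι)) (fun n => s n ^ q.toReal)]
    refine tsum_congr fun n => ?_
    by_cases hn : n ∈ S <;> simp [hn, hp0]

theorem lpE_apply_le_weakSeqNorm (p : ℝ≥0∞) (x : ℕ → X) {φ : StrongDual ℂ X} (hφ : ‖φ‖ ≤ 1) :
    lpE p (fun n => ‖φ (x n)‖ₑ) ≤ weakSeqNorm p x :=
  le_iSup₂ (f := fun (φ : StrongDual ℂ X) (_ : ‖φ‖ ≤ 1) => seqNorm p (fun n => φ (x n))) φ hφ

theorem lpE_apply_le_mul (hp : 1 ≤ p) (x : ℕ → X) (φ : StrongDual ℂ X) :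
    lpE p (fun n => ‖φ (x n)‖ₑ) ≤ ‖φ‖ₑ * weakSeqNorm p x := by
  by_cases h0 : φ = 0
  · subst h0
    have := lpE_const_mul hp 0 (fun _ : ℕ => (0 : ℝ≥0∞))
    simp only [zero_mul] at this
    simp [this]
  · have hn : ‖φ‖ ≠ 0 := norm_ne_zero_iff.2 h0
    have h1 : ‖((‖φ‖ : ℂ)⁻¹ • φ)‖ ≤ 1 := by simp [norm_smul, hn]
    have h2 := lpE_apply_le_weakSeqNorm p x h1
    calc lpE p (fun n => ‖φ (x n)‖ₑ)
        = lpE p (fun n => ‖φ‖ₑ * ‖((‖φ‖ : ℂ)⁻¹ • φ) (x n)‖ₑ) := by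
          congr 1
          ext n
          rw [← enorm_norm φ, ← enorm_norm (((‖φ‖ : ℂ)⁻¹ • φ) (x n)), ← enorm_mul]
          simp [hn]
      _ = ‖φ‖ₑ * lpE p (fun n => ‖((‖φ‖ : ℂ)⁻¹ • φ) (x n)‖ₑ) := lpE_const_mul hp _ _
      _ ≤ _ := by gcongr

theorem weakSeqNorm_le {p : ℝ≥0∞} {x : ℕ → X} {c : ℝ≥0∞}
    (h : ∀ φ : StrongDual ℂ X, ‖φ‖ ≤ 1 → lpE p (fun n => ‖φ (x n)‖ₑ) ≤ c) :
    weakSeqNorm p x ≤ c :=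
  iSup₂_le h

theorem one_le_conjExponent (p : ℝ≥0∞) : 1 ≤ p.conjExponent := le_self_add

theorem conjExponent_eq_top_iff (hp : 1 ≤ p) : p.conjExponent = ∞ ↔ p = 1 := by
  simp only [ENNReal.conjExponent, ENNReal.add_eq_top, ENNReal.one_ne_top, false_or,
    ENNReal.inv_eq_top, tsub_eq_zero_iff_le]
  exact ⟨fun h => le_antisymm h hp, fun h => h.le⟩

/-- Apply Hölder after testing against a norming functional from Hahn–Banach. Keeping the indicator
on the coefficients lets their small tails control the Cauchy criterion. -/
theorem enorm_sum_smul_le (hp : 1 ≤ p) (a : ℕ → ℂ) (x : ℕ → X) (T : Finset ℕ) :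
    ‖∑ n ∈ T, a n • x n‖ₑ ≤
      lpE p.conjExponent ((T : Set ℕ).indicator fun n => ‖a n‖ₑ) * weakSeqNorm p x := by
  obtain ⟨φ, hφ, hφx⟩ := exists_dual_vector'' ℂ (∑ n ∈ T, a n • x n)
  calc ‖∑ n ∈ T, a n • x n‖ₑ = ‖φ (∑ n ∈ T, a n • x n)‖ₑ := by
        rw [hφx]
        exact (enorm_eq_iff_norm_eq.2 (by simp)).symm
    _ = ‖∑ n ∈ T, a n * φ (x n)‖ₑ := by simp [map_sum]
    _ ≤ ∑ n ∈ T, ‖a n‖ₑ * ‖φ (x n)‖ₑ := by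
        refine (enorm_sum_le _ _).trans (le_of_eq ?_)
        simp [enorm_mul]
    _ = ∑ n ∈ T, (T : Set ℕ).indicator (fun n => ‖a n‖ₑ) n * ‖φ (x n)‖ₑ := by
        refine Finset.sum_congr rfl fun n hn => ?_
        simp [hn]
    _ ≤ ∑' n, (T : Set ℕ).indicator (fun n => ‖a n‖ₑ) n * ‖φ (x n)‖ₑ := ENNReal.sum_le_tsum _
    _ ≤ _ := tsum_mul_le_lpE_mul_lpE hp _ _
    _ ≤ _ := by gcongr; exact lpE_apply_le_weakSeqNorm p x hφ

theorem enorm_le_of_hasSum (hp : 1 ≤ p) {a : ℕ → ℂ} {x : ℕ → X} {y : X}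
    (h : HasSum (fun n => a n • x n) y) :
    ‖y‖ₑ ≤ seqNorm p.conjExponent a * weakSeqNorm p x := by
  refine le_of_tendsto (continuous_enorm.continuousAt.tendsto.comp h)
    (Eventually.of_forall fun T => (enorm_sum_smul_le hp a x T).trans ?_)
  gcongr
  exact lpE_mono _ (Set.indicator_le_self' fun _ _ => zero_le)

/-- All smallness comes from the tails of `a`; the weak norm of `x` enters only as a finite factor.
-/
theorem summable_smul [CompleteSpace X] (hp : 1 ≤ p) {a : ℕ → ℂ} {x : ℕ → X}
    (ha : seqNorm p.conjExponent a ≠ ∞) (h0 : p = 1 → Tendsto a atTop (𝓝 0))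
    (hx : weakSeqNorm p x ≠ ∞) : Summable fun n => a n • x n := by
  rw [summable_iff_vanishing_norm]
  intro ε hε
  have htail : ∀ δ : ℝ≥0∞, 0 < δ → ∃ S : Finset ℕ,
      lpE p.conjExponent ((S : Set ℕ)ᶜ.indicator fun n => ‖a n‖ₑ) ≤ δ := fun δ hδ =>
    lpE_exists_tail (one_le_conjExponent p) ha (fun hq => by
      rw [Nat.cofinite_eq_atTop]
      simpa using (h0 ((conjExponent_eq_top_iff hp).1 hq)).enorm) hδ
  obtain ⟨δ, hδ, hδε⟩ : ∃ δ : ℝ≥0∞, 0 < δ ∧ δ * weakSeqNorm p x < ENNReal.ofReal ε := by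
    obtain ⟨δ, hδ, h⟩ := ENNReal.exists_nnreal_pos_mul_lt hx (ENNReal.ofReal_pos.2 hε).ne'
    exact ⟨δ, by exact_mod_cast hδ, h⟩
  obtain ⟨S, hS⟩ := htail δ hδ
  refine ⟨S, fun T hT => ?_⟩
  rw [← ENNReal.ofReal_lt_ofReal_iff hε, ofReal_norm]
  refine (enorm_sum_smul_le hp a x T).trans_lt (lt_of_le_of_lt ?_ hδε)
  gcongr
  refine (lpE_mono _ fun n => ?_).trans hS
  refine Set.indicator_le_indicator_of_subset (fun n hn hnS => ?_) (fun _ => zero_le) n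
  exact Finset.disjoint_left.1 hT hn hnS

theorem weakSeqNorm_le_seqNorm (p : ℝ≥0∞) (x : ℕ → X) : weakSeqNorm p x ≤ seqNorm p x :=
  weakSeqNorm_le fun φ hφ => lpE_mono p fun n => by
    rw [enorm_le_iff_norm_le]
    exact (φ.le_of_opNorm_le hφ _).trans (one_mul _).le

theorem weakSeqNorm_le_genNorm (p : ℝ≥0∞) (x : ℕ → X) (i : Kind) :
    weakSeqNorm p x ≤ genNorm p x i := by
  cases i
  · exact weakSeqNorm_le_seqNorm p x
  all_goals
    unfold genNorm
    split_ifs with h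
    · exact h ▸ weakSeqNorm_le_seqNorm p x
    · exact le_rfl

theorem seqNorm_top_lt_top_iff {Z : Type*} [NormedAddCommGroup Z] {x : ℕ → Z} : seqNorm ∞ x < ∞ ↔ ∃ C : ℝ, ∀ n, ‖x n‖ ≤ C := by
  rw [seqNorm_eq_lpE, lpE_top]
  constructor
  · intro h
    refine ⟨(⨆ n, ‖x n‖ₑ).toReal, fun n => ?_⟩
    rw [← toReal_enorm]
    exact ENNReal.toReal_mono h.ne (le_iSup (fun n => ‖x n‖ₑ) n)
  · rintro ⟨C, hC⟩
    refine lt_of_le_of_lt (iSup_le fun n => ?_) (ENNReal.ofReal_lt_top (r := C))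
    rw [← ofReal_norm]
    exact ENNReal.ofReal_le_ofReal (hC n)

theorem exists_norm_le_of_weakly_null {x : ℕ → X}
    (h : ∀ φ : StrongDual ℂ X, Tendsto (fun n => φ (x n)) atTop (𝓝 0)) :
    ∃ C : ℝ, ∀ n, ‖x n‖ ≤ C := by
  obtain ⟨C, hC⟩ := banach_steinhaus
    (g := fun n => NormedSpace.inclusionInDoubleDual ℂ X (x n)) fun φ => by
      obtain ⟨C, hC⟩ := (h φ).norm.bddAbove_range
      exact ⟨C, fun n => hC ⟨n, rfl⟩⟩
  refine ⟨C, fun n => ?_⟩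
  have := (NormedSpace.inclusionInDoubleDualLi ℂ (E := X)).norm_map (x n)
  exact this ▸ hC n

theorem IsGenerating.genNorm_lt_top {x : ℕ → X} {i : Kind} (h : IsGenerating p x i) :
    genNorm p x i < ∞ := by
  by_cases hp : p = ∞
  · subst hp
    have key : (∃ C : ℝ, ∀ n, ‖x n‖ ≤ C) → genNorm ∞ x i < ∞ := fun hC => by
      have := seqNorm_top_lt_top_iff.2 hC
      cases i <;> simpa [genNorm] using this
    have hb : Tendsto x atTop (𝓝 0) → ∃ C : ℝ, ∀ n, ‖x n‖ ≤ C := fun h => by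
      obtain ⟨C, hC⟩ := h.norm.bddAbove_range
      exact ⟨C, fun n => hC ⟨n, rfl⟩⟩
    cases i <;> simp only [IsGenerating, if_true] at h
    · exact key (hb h)
    · exact key (exists_norm_le_of_weakly_null h)
    · exact key (hb h)
  · cases i <;> simp only [IsGenerating, genNorm, hp, if_false] at h ⊢
    · exact h
    · exact h
    · exact h.1

theorem enorm_le_of_mem_pConv (hp : 1 ≤ p) {x : ℕ → X} {y : X} (hy : y ∈ pConv p x) (i : Kind) :
    ‖y‖ₑ ≤ genNorm p x i := by
  obtain ⟨a, ha, hs⟩ := hy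
  calc ‖y‖ₑ ≤ seqNorm p.conjExponent a * weakSeqNorm p x := enorm_le_of_hasSum hp hs
    _ ≤ 1 * genNorm p x i := by
      gcongr
      · exact ha.1
      · exact weakSeqNorm_le_genNorm p x i
    _ = _ := one_mul _

/-! ### Images under operators -/

theorem lpE_enorm_clm_le (hp : 1 ≤ p) (S : X →L[ℂ] Y) (x : ℕ → X) :
    lpE p (fun n => ‖S (x n)‖ₑ) ≤ ‖S‖ₑ * lpE p (fun n => ‖x n‖ₑ) := by
  rw [← lpE_const_mul hp]
  exact lpE_mono p fun n => S.le_opENorm _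

theorem weakSeqNorm_clm_le (hp : 1 ≤ p) (S : X →L[ℂ] Y) (x : ℕ → X) :
    weakSeqNorm p (fun n => S (x n)) ≤ ‖S‖ₑ * weakSeqNorm p x := by
  refine weakSeqNorm_le fun φ hφ => ?_
  refine (lpE_apply_le_mul hp x (φ.comp S)).trans ?_
  gcongr
  rw [enorm_le_iff_norm_le]
  exact (φ.opNorm_comp_le S).trans (mul_le_of_le_one_left (norm_nonneg _) hφ)

theorem genNorm_clm_le (hp : 1 ≤ p) (S : X →L[ℂ] Y) (x : ℕ → X) (i : Kind) :
    genNorm p (fun n => S (x n)) i ≤ ‖S‖ₑ * genNorm p x i := by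
  cases i
  · exact lpE_enorm_clm_le hp S x
  all_goals
    unfold genNorm
    split_ifs with h
    · exact lpE_enorm_clm_le le_top S x
    · exact weakSeqNorm_clm_le hp S x

theorem IsGenerating.clm (hp : 1 ≤ p) (S : X →L[ℂ] Y) {x : ℕ → X} {i : Kind}
    (h : IsGenerating p x i) : IsGenerating p (fun n => S (x n)) i := by
  have hlim : Tendsto x atTop (𝓝 0) → Tendsto (fun n => S (x n)) atTop (𝓝 0) := fun h => by
    simpa [Function.comp_def] using (S.continuous.tendsto 0).comp h
  have hw : weakSeqNorm p x < ∞ → weakSeqNorm p (fun n => S (x n)) < ∞ := fun h =>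
    (weakSeqNorm_clm_le hp S x).trans_lt (ENNReal.mul_lt_top enorm_lt_top h)
  cases i <;> unfold IsGenerating at h ⊢ <;> split_ifs at h ⊢ with hpt
  · exact hlim h
  · exact (lpE_enorm_clm_le hp S x).trans_lt (ENNReal.mul_lt_top enorm_lt_top h)
  · exact fun φ => h (φ.comp S)
  · exact hw h
  · exact hlim h
  · refine ⟨hw h.1, ?_⟩
    have h2 := ENNReal.Tendsto.const_mul (a := ‖S‖ₑ) h.2 (Or.inr enorm_ne_top)
    rw [mul_zero] at h2
    exact tendsto_of_tendsto_of_tendsto_of_le_of_le tendsto_const_nhds h2 (fun _ => zero_le)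
      fun m => weakSeqNorm_clm_le hp S fun n => x (n + m)

theorem clm_mem_pConv (S : X →L[ℂ] Y) {x : ℕ → X} {y : X} (hy : y ∈ pConv p x) :
    S y ∈ pConv p fun n => S (x n) := by
  obtain ⟨a, ha, hs⟩ := hy
  exact ⟨a, ha, by simpa [map_smul] using hs.mapL S⟩

theorem smul_mem_pConv {x : ℕ → X} {y : X} (hy : y ∈ pConv p x) {t : ℂ} (ht : ‖t‖ ≤ 1) :
    t • y ∈ pConv p x := by
  obtain ⟨a, ha, hs⟩ := hy
  refine ⟨fun n => t * a n, ⟨(lpE_mono _ fun n => ?_).trans ha.1, fun h => ?_⟩, ?_⟩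
  · rw [enorm_le_iff_norm_le, norm_mul]
    exact mul_le_of_le_one_left (norm_nonneg _) ht
  · simpa using (ha.2 h).const_mul t
  · simpa [mul_smul] using hs.const_smul t

theorem zero_mem_pConv (x : ℕ → X) : (0 : X) ∈ pConv p x := by
  refine ⟨0, ⟨?_, fun _ => tendsto_const_nhds⟩, by simp⟩
  have h := lpE_const_mul (one_le_conjExponent p) 0 (fun _ : ℕ => (0 : ℝ≥0∞))
  rw [seqNorm_eq_lpE]
  simp only [Pi.zero_apply, enorm_zero]
  simp only [zero_mul] at h
  rw [h]
  exact zero_le_one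

end Sums

/-! ### Interleaving countably many sequences -/

section Interleave

variable {κ : Type*} {X : Type u} [NormedAddCommGroup X] [NormedSpace ℂ X] {p : ℝ≥0∞}

/-- The scaled rows `c k • x k` arranged in one sequence. -/
def interleave {Z : Type*} [SMul ℂ Z] (e : κ × ℕ ≃ ℕ) (c : κ → ℂ) (x : κ → ℕ → Z) : ℕ → Z :=
  fun m => c (e.symm m).1 • x (e.symm m).1 (e.symm m).2

theorem lpE_interleave {Z : Type*} [NormedAddCommGroup Z] [NormedSpace ℂ Z] (hp : 1 ≤ p)
    (e : κ × ℕ ≃ ℕ) (c : κ → ℂ) (x : κ → ℕ → Z) :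
    lpE p (fun m => ‖interleave e c x m‖ₑ) =
      lpE p (fun k => ‖c k‖ₑ * lpE p (fun n => ‖x k n‖ₑ)) := by
  have h := lpE_comp_equiv p e.symm (fun q : κ × ℕ => ‖c q.1‖ₑ * ‖x q.1 q.2‖ₑ)
  simp only [interleave, enorm_smul]
  rw [h, lpE_prod hp (fun k n => ‖c k‖ₑ * ‖x k n‖ₑ)]
  simp_rw [lpE_const_mul hp]

theorem weakSeqNorm_interleave_le (hp : 1 ≤ p) (e : κ × ℕ ≃ ℕ) (c : κ → ℂ) (x : κ → ℕ → X) :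
    weakSeqNorm p (interleave e c x) ≤ lpE p (fun k => ‖c k‖ₑ * weakSeqNorm p (x k)) := by
  refine weakSeqNorm_le fun φ hφ => ?_
  have h := lpE_interleave hp e c (fun k n => φ (x k n))
  simp only [interleave, map_smul] at h ⊢
  rw [h]
  refine lpE_mono p fun k => ?_
  gcongr
  exact lpE_apply_le_weakSeqNorm p (x k) hφ

theorem genNorm_interleave_le (hp : 1 ≤ p) (e : κ × ℕ ≃ ℕ) (c : κ → ℂ) (x : κ → ℕ → X)
    (i : Kind) :
    genNorm p (interleave e c x) i ≤ lpE p (fun k => ‖c k‖ₑ * genNorm p (x k) i) := by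
  cases i
  · exact (lpE_interleave hp e c x).le
  all_goals
    unfold genNorm
    split_ifs with h
    · subst h
      exact (lpE_interleave hp e c x).le
    · exact weakSeqNorm_interleave_le hp e c x

/-- Only finitely many scaled rows exceed `δ` in supremum norm, and each of these has only finitely
many entries above `δ`. -/
theorem tendsto_interleave {Z : Type*} [NormedAddCommGroup Z] [NormedSpace ℂ Z]
    (e : κ × ℕ ≃ ℕ) {c : κ → ℂ} {x : κ → ℕ → Z} (hx : ∀ k, Tendsto (x k) atTop (𝓝 0))
    (hc : Tendsto (fun k => ‖c k‖ₑ * seqNorm ∞ (x k)) cofinite (𝓝 0)) :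
    Tendsto (interleave e c x) atTop (𝓝 0) := by
  rw [tendsto_zero_iff_enorm_tendsto_zero, ← Nat.cofinite_eq_atTop, ENNReal.tendsto_nhds_zero]
  intro δ hδ
  rw [ENNReal.tendsto_nhds_zero] at hc
  have hK := eventually_cofinite.1 (hc δ hδ)
  have hrow : ∀ k, {n | ¬ ‖c k • x k n‖ₑ ≤ δ}.Finite := fun k => by
    have h := (hx k).const_smul (c k)
    rw [smul_zero, tendsto_zero_iff_enorm_tendsto_zero, ← Nat.cofinite_eq_atTop,
      ENNReal.tendsto_nhds_zero] at h
    exact eventually_cofinite.1 (h δ hδ)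
  rw [eventually_cofinite]
  refine ((hK.biUnion fun k _ => (hrow k).image fun n => e (k, n))).subset fun m hm => ?_
  obtain ⟨⟨k, n⟩, rfl⟩ := e.surjective m
  simp only [interleave, e.symm_apply_apply, Set.mem_ofPred_eq] at hm
  refine Set.mem_biUnion (x := k) (fun hk => hm ?_) ⟨n, hm, rfl⟩
  refine le_trans ?_ hk
  rw [enorm_smul, seqNorm_eq_lpE]
  gcongr
  exact le_lpE le_top (fun n => ‖x k n‖ₑ) n

theorem lpE_eq_shift (hp : 1 ≤ p) (hpt : p ≠ ∞) {s : ℕ → ℝ≥0∞} {N : ℕ} (hs : ∀ n < N, s n = 0) :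
    lpE p s = lpE p (fun n => s (n + N)) := by
  have h0 := toReal_pos_of_one_le hp hpt
  rw [lpE_of_ne_top hpt, lpE_of_ne_top hpt,
    (add_left_injective N).tsum_eq (f := fun n => s n ^ p.toReal)]
  intro n hn
  refine ⟨n - N, Nat.sub_add_cancel (not_lt.1 fun h => hn ?_)⟩
  simp [hs n h, h0]

/-- Rows outside a finite set `K` have small total weak norm, and the rows in `K` have small weak
tails beyond some `N`. The remaining block `K × [0, N)` is finite, so a large shift passes it. -/
theorem tendsto_weakSeqNorm_shift_interleave (hp : 1 ≤ p) (hpt : p ≠ ∞) (e : κ × ℕ ≃ ℕ)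
    {c : κ → ℂ} {x : κ → ℕ → X}
    (hx : ∀ k, Tendsto (fun m : ℕ => weakSeqNorm p (fun n => x k (n + m))) atTop (𝓝 0))
    (hc : ∑' k, ‖c k‖ₑ * weakSeqNorm p (x k) ≠ ∞) :
    Tendsto (fun m : ℕ => weakSeqNorm p (fun n => interleave e c x (n + m))) atTop (𝓝 0) := by
  classical
  rw [ENNReal.tendsto_nhds_zero]
  intro ε hε
  have hε2 : 0 < ε / 2 := ENNReal.half_pos hε.ne'
  obtain ⟨K, hK⟩ :=
    ((ENNReal.tendsto_nhds_zero.1 (ENNReal.tendsto_tsum_compl_atTop_zero hc)) _ hε2).exists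
  have hfin : Tendsto (fun N => ∑ k ∈ K, ‖c k‖ₑ * weakSeqNorm p (fun n => x k (n + N)))
      atTop (𝓝 0) := by
    rw [← Finset.sum_const_zero (s := K)]
    refine tendsto_finsetSum _ fun k _ => ?_
    simpa using ENNReal.Tendsto.const_mul (a := ‖c k‖ₑ) (hx k) (Or.inr enorm_ne_top)
  obtain ⟨N, hN⟩ := ((ENNReal.tendsto_nhds_zero.1 hfin) _ hε2).exists
  -- The finite block is erased. Beyond the largest position in `B` below, interleaving `x` or `y`
  -- gives the same terms.
  let y : κ → ℕ → X := fun k n => if k ∈ K ∧ n < N then 0 else x k n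
  have hyK : ∀ k ∈ K, weakSeqNorm p (y k) ≤ weakSeqNorm p (fun n => x k (n + N)) := by
    refine fun k hk => weakSeqNorm_le fun φ hφ => ?_
    rw [lpE_eq_shift hp hpt (N := N) fun n hn => by simp [y, hk, hn]]
    simpa [y] using lpE_apply_le_weakSeqNorm p (fun n => x k (n + N)) hφ
  have hy : ∑' k, ‖c k‖ₑ * weakSeqNorm p (y k) ≤ ε := by
    have hsplit := ENNReal.sum_add_tsum_compl K fun k => ‖c k‖ₑ * weakSeqNorm p (y k)
    refine hsplit.symm.le.trans (le_of_le_of_eq ?_ (ENNReal.add_halves ε))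
    refine add_le_add (le_trans (Finset.sum_le_sum fun k hk => ?_) hN)
      (le_trans (ENNReal.tsum_le_tsum fun k => ?_) hK)
    · gcongr
      exact hyK k hk
    · have hk : (k : κ) ∉ K := k.2
      simp [y, hk]
  let B : Finset ℕ := (K ×ˢ Finset.range N).image e
  filter_upwards [eventually_gt_atTop (B.sup id)] with M hM
  refine le_trans (weakSeqNorm_le fun φ hφ => ?_) hy
  have heq : ∀ n, interleave e c x (n + M) = interleave e c y (n + M) := fun n => by
    obtain ⟨⟨k, j⟩, hkj⟩ := e.surjective (n + M)
    rw [← hkj]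
    simp only [interleave, e.symm_apply_apply, y]
    rw [if_neg]
    rintro ⟨hk, hj⟩
    have : e (k, j) ∈ B := Finset.mem_image_of_mem _ (by simp [hk, hj])
    have := Finset.le_sup (f := id) this
    rw [hkj] at this
    simp only [id] at this
    omega
  simp_rw [heq]
  calc lpE p (fun n => ‖φ (interleave e c y (n + M))‖ₑ)
      ≤ lpE p (fun n => ‖φ (interleave e c y n)‖ₑ) :=
        lpE_comp_le_of_injective p (add_left_injective M)
          (fun n => ‖φ (interleave e c y n)‖ₑ)
    _ ≤ weakSeqNorm p (interleave e c y) := lpE_apply_le_weakSeqNorm p _ hφ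
    _ ≤ _ := weakSeqNorm_interleave_le hp e c y
    _ ≤ _ := lpE_le_tsum hp _

theorem genNorm_top (x : ℕ → X) (i : Kind) : genNorm ∞ x i = seqNorm ∞ x := by
  cases i <;> simp [genNorm]

theorem IsGenerating.interleave (hp : 1 ≤ p) (e : κ × ℕ ≃ ℕ) {c : κ → ℂ} {x : κ → ℕ → X}
    {i : Kind} (hx : ∀ k, IsGenerating p (x k) i)
    (hc : ∑' k, ‖c k‖ₑ * genNorm p (x k) i ≠ ∞) :
    IsGenerating p (interleave e c x) i := by
  have hz : genNorm p (WeightedHol.interleave e c x) i < ∞ :=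
    ((genNorm_interleave_le hp e c x i).trans (lpE_le_tsum hp _)).trans_lt hc.lt_top
  have hlim := ENNReal.tendsto_cofinite_zero_of_tsum_ne_top hc
  by_cases hpt : p = ∞
  · subst hpt
    simp_rw [genNorm_top] at hlim
    cases i <;> simp only [IsGenerating, if_true] at hx ⊢
    · exact tendsto_interleave e hx hlim
    · intro φ
      have h := tendsto_interleave e (c := c) (x := fun k n => φ (x k n)) (fun k => hx k φ) (by
        have h1 := ENNReal.Tendsto.const_mul (a := ‖φ‖ₑ) hlim (Or.inr enorm_ne_top)
        rw [mul_zero] at h1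
        refine tendsto_of_tendsto_of_tendsto_of_le_of_le tendsto_const_nhds h1
          (fun _ => zero_le) fun k => ?_
        rw [mul_left_comm]
        gcongr
        exact lpE_enorm_clm_le le_top φ (x k))
      refine h.congr fun m => ?_
      simp [WeightedHol.interleave]
    · exact tendsto_interleave e hx hlim
  · cases i <;> simp only [IsGenerating, genNorm, hpt, if_false] at hx hz hc ⊢
    · exact hz
    · exact hz
    · exact ⟨hz, tendsto_weakSeqNorm_shift_interleave hp hpt e (fun k => (hx k).2) hc⟩

/-- The factors `c k` and `(c k)⁻¹` cancel in each product, so summing the interleaved series row by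
row recovers `∑ y k`. The bound on the inverses keeps the merged coefficients in the unit ball, and
`hc1` keeps them null when `p = 1`. -/
theorem exists_hasSum_mem_pConv_interleave [CompleteSpace X] (hp : 1 ≤ p) (e : κ × ℕ ≃ ℕ)
    {c : κ → ℂ} {x : κ → ℕ → X} (hc0 : ∀ k, c k ≠ 0)
    (hc : lpE p.conjExponent (fun k => ‖(c k)⁻¹‖ₑ) ≤ 1)
    (hc1 : p = 1 → Tendsto (fun k => ‖(c k)⁻¹‖ₑ) cofinite (𝓝 0))
    (hz : weakSeqNorm p (interleave e c x) ≠ ∞) {y : κ → X} (hy : ∀ k, y k ∈ pConv p (x k)) :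
    ∃ Y ∈ pConv p (interleave e c x), HasSum y Y := by
  choose a ha hs using hy
  set b := interleave e (fun k => (c k)⁻¹) a with hb
  have hbn : seqNorm p.conjExponent b ≤ 1 := by
    rw [seqNorm_eq_lpE, hb, lpE_interleave (one_le_conjExponent p)]
    refine (lpE_mono _ fun k => ?_).trans hc
    exact mul_le_of_le_one_right zero_le (ha k).1
  have hb0 : p = 1 → Tendsto b atTop (𝓝 0) := fun h1 => by
    refine tendsto_interleave e (fun k => (ha k).2 h1) ?_
    refine tendsto_of_tendsto_of_tendsto_of_le_of_le tendsto_const_nhds (hc1 h1)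
      (fun _ => zero_le) fun k => ?_
    have := (ha k).1
    rw [(conjExponent_eq_top_iff hp).2 h1] at this
    exact mul_le_of_le_one_right zero_le this
  obtain ⟨Y, hY⟩ := summable_smul hp (ne_top_of_le_ne_top ENNReal.one_ne_top hbn) hb0 hz
  refine ⟨Y, ⟨b, ⟨hbn, hb0⟩, hY⟩, ?_⟩
  have h2 := (e.hasSum_iff (f := fun m => b m • interleave e c x m)).2 hY
  refine HasSum.prod_fiberwise h2 fun k => ?_
  refine (hs k).congr_fun ?_
  intro n
  simp [hb, interleave, smul_smul, hc0 k, mul_right_comm]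

theorem lpE_rpow_one_div_le {ι : Type*} (hp : 1 ≤ p) {t : ι → ℝ≥0∞} (ht : ∑' k, t k ≤ 1) :
    lpE p (fun k => t k ^ (1 / p.toReal)) ≤ 1 := by
  by_cases hpt : p = ∞
  · subst hpt
    -- Here `1 / p.toReal = 1 / 0 = 0`, so each entry is `t k ^ 0 = 1`.
    simp [lpE_top]
  · have h0 := toReal_pos_of_one_le hp hpt
    rw [← ENNReal.rpow_le_rpow_iff h0, lpE_rpow hp hpt, ENNReal.one_rpow]
    simp_rw [← ENNReal.rpow_mul, one_div_mul_cancel h0.ne', ENNReal.rpow_one]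
    exact ht

theorem one_div_toReal_add_conjExponent (hp : 1 ≤ p) :
    1 / p.toReal + 1 / p.conjExponent.toReal = 1 := by
  have h : p.HolderConjugate p.conjExponent := .conjExponent hp
  have h1 := h.inv_add_inv_eq_one
  have := congrArg ENNReal.toReal h1
  rw [ENNReal.toReal_add] at this
  · simpa using this
  · simpa using (zero_lt_one.trans_le hp).ne'
  · simpa using (zero_lt_one.trans_le (one_le_conjExponent p)).ne'

/-- The rows get weights `t = A / (A + B)` and `t = B / (A + B)` and are scaled by `t ^ (-1/p*)`. A
scaled row has norm at most `(A + B) * t ^ (1/p)`, and the inverse scalars are `t ^ (1/p*)`. Since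
the weights sum to `1`, both the `ℓ_p` norm of `t ^ (1/p)` and the `ℓ_{p*}` norm of `t ^ (1/p*)` are
at most `1`, so no constant is lost. -/
theorem exists_generating_add [CompleteSpace X] (hp : 1 ≤ p) {i : Kind} {x y : ℕ → X}
    (hx : IsGenerating p x i) (hy : IsGenerating p y i) {A B : ℝ} (hA : 0 < A) (hB : 0 < B)
    (hxA : genNorm p x i ≤ ENNReal.ofReal A) (hyB : genNorm p y i ≤ ENNReal.ofReal B) :
    ∃ z : ℕ → X, IsGenerating p z i ∧ genNorm p z i ≤ ENNReal.ofReal (A + B) ∧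
      ∀ a ∈ pConv p x, ∀ b ∈ pConv p y, a + b ∈ pConv p z := by
  set t : Bool → ℝ := fun k => (if k then A else B) / (A + B) with ht
  have hAB : 0 < A + B := by positivity
  have ht0 : ∀ k, 0 < t k := fun k => by
    cases k <;> simp only [ht] <;> positivity
  have ht1 : ∑' k, ENNReal.ofReal (t k) ≤ 1 := by
    rw [tsum_bool, ← ENNReal.ofReal_add (ht0 _).le (ht0 _).le, ENNReal.ofReal_le_one]
    simp only [ht]
    field_simp
    simp [add_comm]
  set r := 1 / p.conjExponent.toReal with hr
  set c : Bool → ℂ := fun k => ((t k ^ (-r) : ℝ) : ℂ) with hc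
  have hcn : ∀ k, ‖c k‖ₑ = ENNReal.ofReal (t k ^ (-r)) := fun k => by
    rw [← ofReal_norm, hc, Complex.norm_real, Real.norm_of_nonneg (Real.rpow_pos_of_pos (ht0 k) _).le]
  have hc0 : ∀ k, c k ≠ 0 := fun k => by
    simpa [hc] using (Real.rpow_pos_of_pos (ht0 k) (-r)).ne'
  set xs : Bool → ℕ → X := fun k => if k then x else y with hxs
  have hgen : ∀ k, IsGenerating p (xs k) i := by
    intro k
    cases k
    · exact hy
    · exact hx
  have hsum : ∑' k, ‖c k‖ₑ * genNorm p (xs k) i ≠ ∞ := by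
    rw [tsum_bool]
    exact ENNReal.add_ne_top.2 ⟨ENNReal.mul_ne_top enorm_ne_top (hgen _).genNorm_lt_top.ne,
      ENNReal.mul_ne_top enorm_ne_top (hgen _).genNorm_lt_top.ne⟩
  have hz := IsGenerating.interleave hp Equiv.boolProdNatEquivNat hgen hsum
  refine ⟨_, hz, ?_, ?_⟩
  · refine (genNorm_interleave_le hp _ c xs i).trans ?_
    have hle : ∀ k, ‖c k‖ₑ * genNorm p (xs k) i ≤
        ENNReal.ofReal (A + B) * ENNReal.ofReal (t k) ^ (1 / p.toReal) := fun k => by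
      have h1 : genNorm p (xs k) i ≤ ENNReal.ofReal ((A + B) * t k) := by
        have : (A + B) * t k = if k then A else B := by
          simp only [ht]
          field_simp
        rw [this]
        cases k
        · exact hyB
        · exact hxA
      calc ‖c k‖ₑ * genNorm p (xs k) i
          ≤ ENNReal.ofReal (t k ^ (-r)) * ENNReal.ofReal ((A + B) * t k) := by
            rw [hcn]
            gcongr
        _ = ENNReal.ofReal (A + B) * ENNReal.ofReal (t k ^ (1 / p.toReal)) := by
            rw [← ENNReal.ofReal_mul (Real.rpow_pos_of_pos (ht0 k) _).le,
              ← ENNReal.ofReal_mul hAB.le]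
            congr 1
            have hpr : 1 / p.toReal = -r + 1 := by
              linarith [one_div_toReal_add_conjExponent hp]
            rw [hpr, Real.rpow_add_one (ht0 k).ne']
            ring
        _ = _ := by rw [ENNReal.ofReal_rpow_of_pos (ht0 k)]
    refine (lpE_mono p hle).trans ?_
    rw [lpE_const_mul hp]
    exact mul_le_of_le_one_right zero_le (lpE_rpow_one_div_le hp ht1)
  · intro a ha b hb
    obtain ⟨Y, hY, hYs⟩ := exists_hasSum_mem_pConv_interleave hp Equiv.boolProdNatEquivNat
      (c := c) (x := xs) (y := fun k => if k then a else b) hc0 (by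
        refine le_trans (lpE_mono _ fun k => le_of_eq ?_)
          (lpE_rpow_one_div_le (one_le_conjExponent p) ht1)
        rw [enorm_inv (hc0 k), hcn, ← ENNReal.ofReal_rpow_of_pos (ht0 k), ENNReal.rpow_neg, inv_inv])
      (fun _ => by simp [cofinite_eq_bot])
      ((weakSeqNorm_le_genNorm p _ i).trans_lt hz.genNorm_lt_top).ne
      (fun k => by
        cases k
        · exact hb
        · exact ha)
    have := hYs.unique (hasSum_fintype _)
    simp only [Fintype.sum_bool, if_true, Bool.false_eq_true, if_false] at this
    exact this ▸ hY

/-- The inverse weights `2 ^ (-(k + 1))` sum to `1`, so they are null and lie in the unit ball of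
every `ℓ_{p*}`. The crude `ℓ_1` bound on the rows suffices because rapid decay can be arranged. -/
theorem exists_generating_tsum [CompleteSpace X] (hp : 1 ≤ p) {i : Kind} {x : ℕ → ℕ → X}
    (hx : ∀ k, IsGenerating p (x k) i) {C : ℝ≥0∞} (hC : C ≠ ∞)
    (hxC : ∑' k, 2 ^ (k + 1) * genNorm p (x k) i ≤ C) :
    ∃ z : ℕ → X, IsGenerating p z i ∧ genNorm p z i ≤ C ∧
      ∀ y : ℕ → X, (∀ k, y k ∈ pConv p (x k)) → ∃ Y ∈ pConv p z, HasSum y Y := by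
  set c : ℕ → ℂ := fun k => 2 ^ (k + 1) with hc
  have h2 : ‖(2 : ℂ)‖ₑ = 2 := by
    rw [← ofReal_norm]
    simp
  have hcn : ∀ k, ‖c k‖ₑ = 2 ^ (k + 1) := fun k => by simp [hc, enorm_pow, h2]
  have hc0 : ∀ k, c k ≠ 0 := fun k => by simp [hc]
  have hinv : ∀ k, ‖(c k)⁻¹‖ₑ = (2 : ℝ≥0∞)⁻¹ ^ (k + 1) := fun k => by
    rw [enorm_inv (hc0 k), hcn, ENNReal.inv_pow]
  have hsum : ∑' k, ‖(c k)⁻¹‖ₑ = 1 := by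
    simp_rw [hinv]
    rw [ENNReal.tsum_geometric_add_one, ENNReal.one_sub_inv_two, inv_inv]
    exact ENNReal.inv_mul_cancel (by simp) (by simp)
  simp_rw [← hcn] at hxC
  have hz := IsGenerating.interleave hp Nat.pairEquiv hx (ne_top_of_le_ne_top hC hxC)
  refine ⟨_, hz, (genNorm_interleave_le hp _ c x i).trans ((lpE_le_tsum hp _).trans hxC),
    fun y hy => ?_⟩
  exact exists_hasSum_mem_pConv_interleave hp _ hc0
    ((lpE_le_tsum (one_le_conjExponent p) _).trans hsum.le)
    (fun _ => ENNReal.tendsto_cofinite_zero_of_tsum_ne_top (hsum ▸ ENNReal.one_ne_top))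
    ((weakSeqNorm_le_genNorm p _ i).trans_lt hz.genNorm_lt_top).ne hy

end Interleave

/-! ### Holomorphic mappings on Banach spaces -/

section Holomorphic

open Metric

variable {E F G : Type*} [NormedAddCommGroup E] [NormedSpace ℂ E]
  [NormedAddCommGroup F] [NormedSpace ℂ F] [NormedAddCommGroup G] [NormedSpace ℂ G]

theorem circleIntegral_clm_comp_comm [CompleteSpace F] [CompleteSpace G] (T : G →L[ℂ] F)
    {h : ℂ → G} {c : ℂ} {R : ℝ}
    (hh : CircleIntegrable h c R) : ∮ z in C(c, R), T (h z) = T (∮ z in C(c, R), h z) := by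
  simp only [circleIntegral, ← map_smul]
  exact T.intervalIntegral_comp_comm hh.out

/-- A bounded function with values in a separable Banach space is integrable on a circle if its
composition with an injective operator is continuous there. -/
theorem circleIntegrable_of_injective [CompleteSpace G] [SecondCountableTopology G]
    {T : G →L[ℂ] F} (hT : Function.Injective T) {h : ℂ → G} {k : ℂ → F} {c : ℂ} {R M : ℝ}
    (hR : 0 ≤ R) (hk : ContinuousOn k (sphere c R)) (hTh : ∀ z ∈ sphere c R, T (h z) = k z)
    (hM : ∀ z ∈ sphere c R, ‖h z‖ ≤ M) : CircleIntegrable h c R := by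
  let _ : MeasurableSpace G := borel G
  have : BorelSpace G := ⟨rfl⟩
  let _ : MeasurableSpace F := borel F
  have : BorelSpace F := ⟨rfl⟩
  have hmem : ∀ θ : ℝ, circleMap c R θ ∈ sphere c R := fun θ => circleMap_mem_sphere c hR θ
  have hmeas : Measurable fun θ : ℝ => h (circleMap c R θ) := by
    -- Lusin–Souslin: `G` is Polish, so `h` is measurable as soon as `T ∘ h` is. No continuity of
    -- `h` is known yet.
    have hemb := T.continuous.measurableEmbedding hT
    refine hemb.measurable_comp_iff.1 ?_
    have : T ∘ (fun θ : ℝ => h (circleMap c R θ)) = fun θ => k (circleMap c R θ) :=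
      funext fun θ => hTh _ (hmem θ)
    rw [this]
    exact (hk.comp_continuous (continuous_circleMap c R) hmem).measurable
  refine (MeasureTheory.Measure.integrableOn_of_bounded (M := M) ?_
    hmeas.aestronglyMeasurable ?_).intervalIntegrable
  · rw [Set.uIcc_of_le (by positivity)]
    exact isCompact_Icc.measure_lt_top.ne
  · exact Eventually.of_forall fun θ => hM _ (hmem θ)

/-- The first order Taylor expansion at `0` can be lifted through an injective operator. -/
theorem exists_taylor_lift [CompleteSpace F] [CompleteSpace G] [SecondCountableTopology G]
    {T : G →L[ℂ] F} (hT : Function.Injective T) {h : ℂ → G} {k : ℂ → F} {R M : ℝ}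
    (hR : 0 < R) {V : Set ℂ} (hV : IsOpen V) (hRV : closedBall 0 R ⊆ V)
    (hk : DifferentiableOn ℂ k V) (hTh : ∀ z ∈ closedBall (0 : ℂ) R, T (h z) = k z)
    (hM : ∀ z ∈ sphere (0 : ℂ) R, ‖h z‖ ≤ M) :
    ∃ l : G, T l = deriv k 0 ∧ ‖l‖ ≤ M / R ∧
      (2 ≤ R → ‖h 1 - h 0 - l‖ ≤ 2 * M / R ^ 2) := by
  have hsV : sphere (0 : ℂ) R ⊆ V := sphere_subset_closedBall.trans hRV
  have hhI : CircleIntegrable h 0 R := circleIntegrable_of_injective hT hR.le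
    (hk.continuousOn.mono hsV) (fun z hz => hTh z (sphere_subset_closedBall hz)) hM
  -- The Cauchy integral of `h` with kernel `c`, formed in `G`; `T` maps it to the corresponding
  -- integral of `k`.
  let J : (ℂ → ℂ) → G := fun c => (2 * Real.pi * Complex.I : ℂ)⁻¹ • ∮ z in C(0, R), c z • h z
  have hcI : ∀ c : ℂ → ℂ, ContinuousOn c (sphere 0 R) →
      CircleIntegrable (fun z => c z • h z) 0 R := fun c hc =>
    hhI.continuousOn_smul (by rwa [abs_of_pos hR])
  have hJsub : ∀ c d : ℂ → ℂ, ContinuousOn c (sphere 0 R) → ContinuousOn d (sphere 0 R) →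
      J c - J d = J fun z => c z - d z := fun c d hc hd => by
    simp only [J, sub_smul]
    rw [← smul_sub, ← circleIntegral.integral_sub (hcI c hc) (hcI d hd)]
  have hTJ : ∀ c : ℂ → ℂ, ContinuousOn c (sphere 0 R) →
      T (J c) = (2 * Real.pi * Complex.I : ℂ)⁻¹ • ∮ z in C(0, R), c z • k z := fun c hc => by
    simp only [J, map_smul]
    rw [← circleIntegral_clm_comp_comm T (hcI c hc)]
    congr 1
    refine circleIntegral.integral_congr hR.le fun z hz => ?_
    simp only [map_smul, hTh z (sphere_subset_closedBall hz)]
  have hne : ∀ z ∈ sphere (0 : ℂ) R, ∀ w ∈ ball (0 : ℂ) R, z - w ≠ 0 := fun z hz w hw h0 =>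
    sphere_disjoint_ball.ne_of_mem hz hw (sub_eq_zero.1 h0)
  have hc1 : ∀ w ∈ ball (0 : ℂ) R, ContinuousOn (fun z : ℂ => (z - w)⁻¹) (sphere 0 R) :=
    fun w hw => (continuous_id.sub continuous_const).continuousOn.inv₀ fun z hz => hne z hz w hw
  have h0R : (0 : ℂ) ∈ ball (0 : ℂ) R := mem_ball_self hR
  have hc2 : ContinuousOn (fun z : ℂ => ((z - 0) ^ 2)⁻¹) (sphere 0 R) :=
    ((continuous_id.sub continuous_const).pow 2).continuousOn.inv₀ fun z hz =>
      pow_ne_zero 2 (hne z hz 0 h0R)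
  -- Cauchy's formula holds for `k`, and injectivity of `T` carries it back to `h`.
  have hval : ∀ w ∈ ball (0 : ℂ) R, J (fun z => (z - w)⁻¹) = h w := fun w hw => hT (by
    rw [hTJ _ (hc1 w hw), hTh w (ball_subset_closedBall hw)]
    exact (hk.diffContOnCl_ball hRV).two_pi_i_inv_smul_circleIntegral_sub_inv_smul hw)
  refine ⟨J fun z => ((z - 0) ^ 2)⁻¹, ?_, ?_, fun hR2 => ?_⟩
  · rw [hTJ _ hc2]
    exact Complex.two_pi_I_inv_smul_circleIntegral_sub_sq_inv_smul_of_differentiable hV hRV hk h0R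
  · refine (circleIntegral.norm_two_pi_i_inv_smul_integral_le_of_norm_le_const hR.le
      (C := M / R ^ 2) fun z hz => ?_).trans (le_of_eq (by field_simp))
    rw [norm_smul, norm_inv, norm_pow, sub_zero, mem_sphere_zero_iff_norm.1 hz, inv_mul_eq_div]
    gcongr
    exact hM z hz
  · have h1R : (1 : ℂ) ∈ ball (0 : ℂ) R := by
      rw [mem_ball_zero_iff, norm_one]
      linarith
    rw [← hval 1 h1R, ← hval 0 h0R]
    rw [hJsub _ _ (hc1 1 h1R) (hc1 0 h0R), hJsub (fun z => (z - 1)⁻¹ - (z - 0)⁻¹) _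
      ((hc1 1 h1R).sub (hc1 0 h0R)) hc2]
    refine (circleIntegral.norm_two_pi_i_inv_smul_integral_le_of_norm_le_const hR.le
      (C := 2 * M / R ^ 3) fun z hz => ?_).trans (le_of_eq (by field_simp))
    have hz0 : z ≠ 0 := by simpa using hne z hz 0 h0R
    have hz1 : z - 1 ≠ 0 := hne z hz 1 h1R
    have hzR : ‖z‖ = R := mem_sphere_zero_iff_norm.1 hz
    have hz2 : R / 2 ≤ ‖z - 1‖ := by
      have := norm_sub_norm_le z 1
      rw [hzR, norm_one] at this
      linarith
    -- This is the kernel of the Taylor remainder. With `‖z - 1‖ ≥ R / 2` it is at most `2 / R ^ 3`,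
    -- and the circle contributes a factor `R`.
    have hid : (z - 1)⁻¹ - (z - 0)⁻¹ - ((z - 0) ^ 2)⁻¹ = (z ^ 2 * (z - 1))⁻¹ := by
      rw [sub_zero]
      field_simp
      ring
    beta_reduce
    rw [hid, norm_smul, norm_inv, norm_mul, norm_pow, hzR, inv_mul_eq_div]
    have hM0 : 0 ≤ M := (norm_nonneg _).trans (hM z hz)
    calc ‖h z‖ / (R ^ 2 * ‖z - 1‖) ≤ M / (R ^ 2 * (R / 2)) := by
          gcongr
          exact hM z hz
      _ = 2 * M / R ^ 3 := by field_simp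

theorem mapsTo_line {x e : E} {r : ℝ} (he : e ≠ 0) :
    Set.MapsTo (fun z : ℂ => x + z • e) (closedBall 0 (r / (2 * ‖e‖))) (closedBall x (r / 2)) := by
  intro z hz
  have he' : 0 < ‖e‖ := norm_pos_iff.2 he
  rw [mem_closedBall_zero_iff] at hz
  rw [mem_closedBall_iff_norm, add_sub_cancel_left, norm_smul]
  calc ‖z‖ * ‖e‖ ≤ r / (2 * ‖e‖) * ‖e‖ := by gcongr
    _ = r / 2 := by field_simp

theorem differentiableOn_line {f : E → F} {x : E} {r : ℝ} (hf : DifferentiableOn ℂ f (ball x r))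
    (e : E) : DifferentiableOn ℂ (fun z : ℂ => f (x + z • e)) {z | x + z • e ∈ ball x r} := by
  refine hf.comp (f := fun z : ℂ => x + z • e) ?_ fun z hz => hz
  exact (by fun_prop : Differentiable ℂ fun z : ℂ => x + z • e).differentiableOn

theorem deriv_line {f : E → F} {x : E} (hf : DifferentiableAt ℂ f x) (e : E) :
    deriv (fun z : ℂ => f (x + z • e)) 0 = fderiv ℂ f x e := by
  have h1 : HasDerivAt (fun z : ℂ => x + z • e) e 0 := by
    simpa using ((hasDerivAt_id (0 : ℂ)).smul_const e).const_add x
  have h2 : HasFDerivAt f (fderiv ℂ f x) ((fun z : ℂ => x + z • e) 0) := by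
    simpa using hf.hasFDerivAt
  exact (h2.comp_hasDerivAt (0 : ℂ) h1).deriv

/-- A bounded mapping with values in a separable Banach space is holomorphic if its composition
with an injective operator is. -/
theorem differentiableAt_of_injective [CompleteSpace F] [CompleteSpace G]
    [SecondCountableTopology G]
    {T : G →L[ℂ] F} (hT : Function.Injective T) {f : E → F} {g : E → G} {x : E} {r M : ℝ}
    (hr : 0 < r) (hf : DifferentiableOn ℂ f (ball x r)) (hTg : ∀ y ∈ ball x r, T (g y) = f y)
    (hM : ∀ y ∈ ball x r, ‖g y‖ ≤ M) : DifferentiableAt ℂ g x := by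
  have hfx : DifferentiableAt ℂ f x := (hf x (mem_ball_self hr)).differentiableAt (ball_mem_nhds x hr)
  have hsub : closedBall x (r / 2) ⊆ ball x r := closedBall_subset_ball (by linarith)
  -- The Taylor lift is applied on the line `x + z • e` with `R = r / (2 * ‖e‖)`; then `2 ≤ R` means
  -- `‖e‖ ≤ r / 4`.
  have key : ∀ e : E, ∃ l : G, T l = fderiv ℂ f x e ∧ ‖l‖ ≤ 2 * M / r * ‖e‖ ∧
      (‖e‖ ≤ r / 4 → ‖g (x + e) - g x - l‖ ≤ 8 * M / r ^ 2 * ‖e‖ ^ 2) := by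
    intro e
    by_cases he : e = 0
    · subst he
      exact ⟨0, by simp, by simp, by simp⟩
    have he' : 0 < ‖e‖ := norm_pos_iff.2 he
    obtain ⟨l, hl1, hl2, hl3⟩ := exists_taylor_lift hT (h := fun z : ℂ => g (x + z • e))
      (k := fun z : ℂ => f (x + z • e)) (R := r / (2 * ‖e‖)) (M := M) (by positivity)
      (isOpen_ball.preimage (by fun_prop : Continuous fun z : ℂ => x + z • e))
      (fun z hz => hsub (mapsTo_line he hz)) (differentiableOn_line hf e)
      (fun z hz => hTg _ (hsub (mapsTo_line he hz)))
      (fun z hz => hM _ (hsub (mapsTo_line he (sphere_subset_closedBall hz))))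
    refine ⟨l, hl1.trans (deriv_line hfx e), hl2.trans (le_of_eq (by field_simp)), fun her => ?_⟩
    simp only [one_smul, zero_smul, add_zero] at hl3
    refine (hl3 ?_).trans (le_of_eq (by field_simp; ring))
    rw [le_div_iff₀ (by positivity)]
    linarith
  choose l hl1 hl2 hl3 using key
  -- The vectors `l e` were chosen separately; they depend linearly on `e` because their images
  -- under `T` do.
  let L₀ : E →ₗ[ℂ] G :=
    { toFun := l
      map_add' := fun a b => hT (by simp [hl1])
      map_smul' := fun c a => hT (by simp [hl1]) }
  let L : E →L[ℂ] G := L₀.mkContinuous (2 * M / r) hl2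
  have hL : HasFDerivAt g L x := by
    rw [hasFDerivAt_iff_isLittleO_nhds_zero]
    refine Asymptotics.IsBigO.trans_isLittleO (g := fun e : E => ‖e‖ ^ 2) ?_
      (Asymptotics.isLittleO_norm_pow_id one_lt_two)
    refine Asymptotics.IsBigO.of_bound (8 * M / r ^ 2) ?_
    filter_upwards [closedBall_mem_nhds (0 : E) (by positivity : 0 < r / 4)] with e he
    rw [norm_pow, norm_norm]
    exact hl3 e (mem_closedBall_zero_iff.1 he)
  exact hL.differentiableAt

/-- Cauchy's estimate on each complex line through `x`. The factor `2` is the cost of using radius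
`r / 2`, which keeps closed discs inside the open ball. -/
theorem norm_fderiv_le_of_ball {f : E → F} {x : E} {r M : ℝ} (hr : 0 < r)
    (hf : DifferentiableOn ℂ f (ball x r)) (hM : ∀ y ∈ ball x r, ‖f y‖ ≤ M) :
    ‖fderiv ℂ f x‖ ≤ 2 * M / r := by
  have hx := mem_ball_self (x := x) hr
  have hfx : DifferentiableAt ℂ f x := (hf x hx).differentiableAt (ball_mem_nhds x hr)
  have hM0 : 0 ≤ M := (norm_nonneg _).trans (hM x hx)
  have hsub : closedBall x (r / 2) ⊆ ball x r := closedBall_subset_ball (by linarith)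
  refine ContinuousLinearMap.opNorm_le_bound _ (by positivity) fun e => ?_
  by_cases he : e = 0
  · simp [he]
  have he' : 0 < ‖e‖ := norm_pos_iff.2 he
  rw [← deriv_line hfx e]
  refine (Complex.norm_deriv_le_of_forall_mem_sphere_norm_le (R := r / (2 * ‖e‖)) (C := M)
    (by positivity) ?_ fun z hz => ?_).trans (le_of_eq (by field_simp))
  · exact (differentiableOn_line hf e).diffContOnCl_ball fun z hz => hsub (mapsTo_line he hz)
  · exact hM _ (hsub (mapsTo_line he (sphere_subset_closedBall hz)))

/-- This converts weighted bounds into uniform bounds near each point, where Cauchy estimates apply.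
-/
theorem Weight.exists_ball {E : Type u} [NormedAddCommGroup E] {U : Opens E} (v : Weight U)
    (x : U) : ∃ r > 0, ∃ δ > 0, ∃ h : ball (x : E) r ⊆ U,
      ∀ y (hy : y ∈ ball (x : E) r), δ ≤ v.toFun ⟨y, h hy⟩ := by
  have h1 : ∀ᶠ y : U in 𝓝 x, v.toFun x / 2 < v.toFun y :=
    v.continuous_toFun.continuousAt.eventually (lt_mem_nhds (half_lt_self (v.pos x)))
  have h2 := (U.isOpenEmbedding'.map_nhds_eq x) ▸ (image_mem_map h1 : _ ∈ map Subtype.val (𝓝 x))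
  obtain ⟨r, hr, hb⟩ := Metric.mem_nhds_iff.1 h2
  refine ⟨r, hr, v.toFun x / 2, half_pos (v.pos x), fun y hy => ?_, fun y hy => ?_⟩
  · obtain ⟨z, -, rfl⟩ := hb hy
    exact z.2
  · obtain ⟨z, hz, rfl⟩ := hb hy
    exact le_of_lt hz

end Holomorphic

/-! ### Holomorphy of lifts and limits under weighted bounds -/

section Lift

open Metric

variable {E : Type u} [NormedAddCommGroup E] {U : Opens E}
  {F G : Type*} [NormedAddCommGroup F] [NormedAddCommGroup G]

open Classical in
/-- The extension of a mapping on `U` by zero. -/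
def extendZero (f : U → F) (y : E) : F := if h : y ∈ U then f ⟨y, h⟩ else 0

@[simp] theorem extendZero_coe (f : U → F) (x : U) : extendZero f x = f x := by
  simp [extendZero]

theorem extendZero_of_mem (f : U → F) {y : E} (hy : y ∈ U) : extendZero f y = f ⟨y, hy⟩ := by
  simp [extendZero, hy]

variable [NormedSpace ℂ E] [NormedSpace ℂ F] [NormedSpace ℂ G]

theorem isHolomorphic_iff {f : U → F} :
    IsHolomorphic f ↔ DifferentiableOn ℂ (extendZero f) (U : Set E) := by
  constructor
  · rintro ⟨g, hg, hgf⟩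
    exact hg.congr fun y hy => by rw [extendZero_of_mem f hy, ← hgf]
  · exact fun h => ⟨extendZero f, h, fun x => extendZero_coe f x⟩

theorem IsHolomorphic.of_injective [CompleteSpace F] [CompleteSpace G] [SecondCountableTopology G]
    {T : G →L[ℂ] F} (hT : Function.Injective T) (v : Weight U) {f : U → F} {g : U → G}
    (hf : IsHolomorphic f) (hTg : ∀ x, T (g x) = f x) {C : ℝ} (hC : ∀ x, v.toFun x * ‖g x‖ ≤ C) :
    IsHolomorphic g := by
  rw [isHolomorphic_iff] at hf ⊢
  intro x hx
  obtain ⟨r, hr, δ, hδ, hU, hv⟩ := v.exists_ball ⟨x, hx⟩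
  refine (differentiableAt_of_injective hT (M := C / δ) hr (hf.mono hU) (fun y hy => ?_)
    fun y hy => ?_).differentiableWithinAt
  · rw [extendZero_of_mem _ (hU hy), extendZero_of_mem _ (hU hy), hTg]
  · rw [extendZero_of_mem _ (hU hy), le_div_iff₀ hδ, mul_comm]
    exact (mul_le_mul_of_nonneg_right (hv y hy) (norm_nonneg _)).trans (hC _)

/-- A Cauchy sequence for the weighted norm is locally uniformly Cauchy. By Cauchy estimates so are
the derivatives, and the limit may be differentiated. -/
theorem IsHolomorphic.of_tendsto [CompleteSpace F] (v : Weight U) {s : ℕ → U → F} {f : U → F}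
    (hs : ∀ n, IsHolomorphic (s n)) (hlim : ∀ x, Tendsto (fun n => s n x) atTop (𝓝 (f x)))
    (hcau : ∀ ε > 0, ∃ N, ∀ m ≥ N, ∀ n ≥ N, ∀ x, v.toFun x * ‖s m x - s n x‖ ≤ ε) :
    IsHolomorphic f := by
  simp_rw [isHolomorphic_iff] at hs ⊢
  intro x hx
  obtain ⟨r, hr, δ, hδ, hU, hv⟩ := v.exists_ball ⟨x, hx⟩
  have hball : ∀ y ∈ ball x (r / 2), ball y (r / 2) ⊆ ball x r := fun y hy z hz => by
    have := dist_triangle z y x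
    simp only [mem_ball] at hy hz ⊢
    linarith
  have hdiff : ∀ n, ∀ y ∈ ball x (r / 2), DifferentiableAt ℂ (extendZero (s n)) y := fun n y hy =>
    (hs n y (hU (hball y hy (mem_ball_self (by positivity))))).differentiableAt
      (U.isOpen.mem_nhds (hU (hball y hy (mem_ball_self (by positivity)))))
  have hC : UniformCauchySeqOn (fun n => fderiv ℂ (extendZero (s n))) atTop (ball x (r / 2)) := by
    rw [Metric.uniformCauchySeqOn_iff]
    intro ε hε
    -- Dividing by the lower bound `δ` of the weight leaves `ε * r / 8`; Cauchy's estimate on radius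
    -- `r / 2` then gives `ε / 2`.
    obtain ⟨N, hN⟩ := hcau (ε * δ * r / 8) (by positivity)
    refine ⟨N, fun m hm n hn y hy => ?_⟩
    rw [dist_eq_norm, ← fderiv_sub (hdiff m y hy) (hdiff n y hy)]
    refine (norm_fderiv_le_of_ball (r := r / 2) (M := ε * r / 8) (by positivity)
      (((hs m).sub (hs n)).mono ((hball y hy).trans hU)) fun z hz => ?_).trans_lt ?_
    · have hzr := hball y hy hz
      rw [Pi.sub_apply, extendZero_of_mem _ (hU hzr), extendZero_of_mem _ (hU hzr)]
      have h1 := (mul_le_mul_of_nonneg_right (hv z hzr) (norm_nonneg _)).trans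
        (hN m hm n hn ⟨z, hU hzr⟩)
      refine le_of_mul_le_mul_left (h1.trans (le_of_eq ?_)) hδ
      ring
    · field_simp
      norm_num
  have hlim' : ∀ y ∈ ball x (r / 2), ∃ L, Tendsto (fun n => fderiv ℂ (extendZero (s n)) y)
      atTop (𝓝 L) := fun y hy => cauchySeq_tendsto_of_complete (hC.cauchySeq hy)
  choose! g' hg' using hlim'
  have hunif := hC.tendstoUniformlyOn_of_tendsto hg'
  refine (hasFDerivAt_of_tendstoUniformlyOn isOpen_ball hunif
    (fun n y hy => (hdiff n y hy).hasFDerivAt) (fun y hy => ?_)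
    (mem_ball_self (by positivity))).differentiableAt.differentiableWithinAt
  have hyU := hU (hball y hy (mem_ball_self (by positivity)))
  simp_rw [extendZero_of_mem _ hyU]
  exact hlim _

end Lift

/-! ### Factorization through a quotient of the coefficient space -/

section Factor

theorem memℓp_of_seqNorm_ne_top {q : ℝ≥0∞} (hq : 1 ≤ q) {a : ℕ → ℂ} (ha : seqNorm q a ≠ ∞) :
    Memℓp a q := by
  by_cases hqt : q = ∞
  · subst hqt
    obtain ⟨C, hC⟩ := seqNorm_top_lt_top_iff.1 ha.lt_top
    exact memℓp_infty ⟨C, by rintro _ ⟨n, rfl⟩; exact hC n⟩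
  · have h0 := toReal_pos_of_one_le hq hqt
    refine memℓp_gen ?_
    have hs : ∑' n, ‖a n‖ₑ ^ q.toReal ≠ ∞ := by
      rw [← lpE_rpow hq hqt]
      exact ENNReal.rpow_ne_top_of_nonneg h0.le ha
    simpa [← ENNReal.toReal_rpow] using ENNReal.summable_toReal hs

theorem seqNorm_lp {q : ℝ≥0∞} [hq : Fact (1 ≤ q)] (f : lp (fun _ : ℕ => ℂ) q) :
    seqNorm q f = ‖f‖ₑ := by
  by_cases hqt : q = ∞
  · subst hqt
    rw [seqNorm_eq_lpE, lpE_top]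
    refine le_antisymm (iSup_le fun n => ?_) ?_
    · rw [enorm_le_iff_norm_le]
      exact lp.norm_apply_le_norm (by simp) f n
    · have hfin : ⨆ n, ‖f n‖ₑ ≠ ∞ := by
        refine ne_top_of_le_ne_top (enorm_ne_top (x := f)) (iSup_le fun n => ?_)
        rw [enorm_le_iff_norm_le]
        exact lp.norm_apply_le_norm (by simp) f n
      rw [← ofReal_norm, ENNReal.ofReal_le_iff_le_toReal hfin]
      refine lp.norm_le_of_forall_le ENNReal.toReal_nonneg fun n => ?_
      rw [← toReal_enorm]
      exact ENNReal.toReal_mono hfin (le_iSup (fun n => ‖f n‖ₑ) n)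
  · have h0 := toReal_pos_of_one_le hq.out hqt
    have hsum : Summable fun n => ‖f n‖ ^ q.toReal := (lp.memℓp f).summable h0
    rw [← (ENNReal.rpow_left_injective h0.ne').eq_iff, seqNorm_eq_lpE, lpE_rpow hq.out hqt,
      ← ofReal_norm f, ENNReal.ofReal_rpow_of_nonneg (norm_nonneg _) h0.le,
      lp.norm_rpow_eq_tsum h0, ENNReal.ofReal_tsum_of_nonneg (fun n => by positivity) hsum]
    refine tsum_congr fun n => ?_
    rw [← ofReal_norm, ENNReal.ofReal_rpow_of_nonneg (norm_nonneg _) h0.le]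

/-- The closed span of the unit vectors in `ℓ_q`: this is `ℓ_q` for finite `q`, and `c₀` for
`q = ∞`. -/
def coefSpace (q : ℝ≥0∞) [Fact (1 ≤ q)] : Submodule ℂ (lp (fun _ : ℕ => ℂ) q) :=
  (Submodule.span ℂ (Set.range fun n : ℕ => lp.single q n (1 : ℂ))).topologicalClosure

instance (p : ℝ≥0∞) : Fact (1 ≤ p.conjExponent) := ⟨one_le_conjExponent p⟩

variable {q : ℝ≥0∞} [hq : Fact (1 ≤ q)]

instance : CompleteSpace (coefSpace q) :=
  (Submodule.isClosed_topologicalClosure _).completeSpace_coe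

instance : SecondCountableTopology (coefSpace q) := by
  have h : IsSeparable (coefSpace q : Set (lp (fun _ : ℕ => ℂ) q)) :=
    (Set.countable_range _).isSeparable.span.closure
  have : SeparableSpace (coefSpace q) := h.separableSpace
  exact UniformSpace.secondCountable_of_separable _

/-- Finite truncations converge to `f` by smallness of tails. With the converse
`tendsto_of_mem_coefSpace`, the unit ball of `coefSpace` at the conjugate exponent is exactly
`coefBall`. -/
theorem mem_coefSpace {f : lp (fun _ : ℕ => ℂ) q} (hf : q = ∞ → Tendsto f atTop (𝓝 0)) :
    f ∈ coefSpace q := by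
  refine Metric.mem_closure_iff.2 fun ε hε => ?_
  obtain ⟨S, hS⟩ := lpE_exists_tail hq.out (s := fun n => ‖f n‖ₑ) (ε := ENNReal.ofReal (ε / 2))
    (by rw [← seqNorm_eq_lpE, seqNorm_lp]; exact enorm_ne_top)
    (fun h => by
      rw [Nat.cofinite_eq_atTop]
      simpa using (hf h).enorm) (by simpa using hε)
  refine ⟨∑ n ∈ S, f n • lp.single q n (1 : ℂ), Submodule.sum_mem _ fun n _ =>
    Submodule.smul_mem _ _ (Submodule.subset_span ⟨n, rfl⟩), ?_⟩
  rw [dist_eq_norm, ← ENNReal.ofReal_lt_ofReal_iff hε, ofReal_norm, ← seqNorm_lp, seqNorm_eq_lpE]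
  refine lt_of_le_of_lt ((lpE_mono q fun n => ?_).trans hS)
    ((ENNReal.ofReal_lt_ofReal_iff hε).2 (half_lt_self hε))
  have hval : (f - ∑ n ∈ S, f n • lp.single q n (1 : ℂ) : lp (fun _ : ℕ => ℂ) q) n =
      if n ∈ S then 0 else f n := by
    rw [lp.coeFn_sub, Pi.sub_apply, lp.coeFn_sum, Finset.sum_apply]
    simp [lp.single_apply, Pi.single_apply]
    split_ifs <;> simp
  rw [hval]
  by_cases hn : n ∈ S <;> simp [hn]

theorem tendsto_of_mem_coefSpace {f : lp (fun _ : ℕ => ℂ) q} (hf : f ∈ coefSpace q) :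
    Tendsto f atTop (𝓝 0) := by
  have hspan : ∀ g ∈ Submodule.span ℂ (Set.range fun n : ℕ => lp.single q n (1 : ℂ)),
      Tendsto (g : ℕ → ℂ) atTop (𝓝 0) := fun g hg => by
    induction hg using Submodule.span_induction with
    | mem g hg =>
      obtain ⟨n, rfl⟩ := hg
      refine tendsto_const_nhds.congr' ?_
      filter_upwards [eventually_gt_atTop n] with m hm
      simp [lp.single_apply, hm.ne']
    | zero => exact tendsto_const_nhds
    | add g h _ _ hg hh =>
      rw [lp.coeFn_add, ← add_zero (0 : ℂ)]
      exact hg.add hh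
    | smul c g _ hg =>
      rw [lp.coeFn_smul, ← smul_zero c]
      exact hg.const_smul c
  rw [Metric.tendsto_nhds]
  intro ε hε
  obtain ⟨g, hg, hfg⟩ := Metric.mem_closure_iff.1 hf (ε / 2) (half_pos hε)
  filter_upwards [Metric.tendsto_nhds.1 (hspan g hg) (ε / 2) (half_pos hε)] with n hn
  have h1 : ‖f n - g n‖ ≤ ‖f - g‖ :=
    lp.norm_apply_le_norm (zero_lt_one.trans_le hq.out).ne' (f - g) n
  rw [dist_eq_norm] at hfg
  rw [dist_zero_right] at hn ⊢
  calc ‖f n‖ = ‖(f n - g n) + g n‖ := by rw [sub_add_cancel]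
    _ ≤ ‖f n - g n‖ + ‖g n‖ := norm_add_le _ _
    _ < ε := by linarith

variable {F : Type u} [NormedAddCommGroup F] [NormedSpace ℂ F] [CompleteSpace F] {p : ℝ≥0∞}

theorem summable_coefSpace [Fact (1 ≤ p)] {x : ℕ → F} (hx : weakSeqNorm p x ≠ ∞)
    (f : coefSpace p.conjExponent) :
    Summable fun n => (f : lp (fun _ : ℕ => ℂ) p.conjExponent) n • x n :=
  summable_smul (Fact.out : 1 ≤ p) (by rw [seqNorm_lp]; exact enorm_ne_top)
    (fun _ => tendsto_of_mem_coefSpace f.2) hx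

/-- The operator that sends a coefficient sequence `(a n)` to `∑ a n • x n`. -/
def synthesis [Fact (1 ≤ p)] {x : ℕ → F} (hx : weakSeqNorm p x ≠ ∞) :
    coefSpace p.conjExponent →L[ℂ] F :=
  LinearMap.mkContinuous
    { toFun := fun f => ∑' n, (f : lp (fun _ : ℕ => ℂ) p.conjExponent) n • x n
      map_add' := fun f g => by
        rw [← (summable_coefSpace hx f).tsum_add (summable_coefSpace hx g)]
        simp [add_smul]
      map_smul' := fun c f => by
        rw [RingHom.id_apply, ← (summable_coefSpace hx f).tsum_const_smul c]
        simp [mul_smul] }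
    (weakSeqNorm p x).toReal fun f => by
      have h := enorm_le_of_hasSum (Fact.out : 1 ≤ p) (summable_coefSpace hx f).hasSum
      rw [seqNorm_lp] at h
      have h2 := ENNReal.toReal_mono (ENNReal.mul_ne_top enorm_ne_top hx) h
      rw [ENNReal.toReal_mul, toReal_enorm, toReal_enorm, mul_comm] at h2
      exact h2

theorem hasSum_synthesis [Fact (1 ≤ p)] {x : ℕ → F} (hx : weakSeqNorm p x ≠ ∞)
    (f : coefSpace p.conjExponent) :
    HasSum (fun n => (f : lp (fun _ : ℕ => ℂ) p.conjExponent) n • x n) (synthesis hx f) :=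
  (summable_coefSpace hx f).hasSum

theorem synthesis_mem_pConv [hp : Fact (1 ≤ p)] {x : ℕ → F} (hx : weakSeqNorm p x ≠ ∞)
    {f : coefSpace p.conjExponent} (hf : ‖f‖ ≤ 1) : synthesis hx f ∈ pConv p x := by
  refine ⟨_, ⟨?_, fun _ => tendsto_of_mem_coefSpace f.2⟩, hasSum_synthesis hx f⟩
  rw [seqNorm_lp, ← ofReal_norm, ENNReal.ofReal_le_one]
  exact hf

theorem exists_synthesis_eq [hp : Fact (1 ≤ p)] {x : ℕ → F} (hx : weakSeqNorm p x ≠ ∞)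
    {y : F} (hy : y ∈ pConv p x) : ∃ f : coefSpace p.conjExponent, ‖f‖ ≤ 1 ∧ synthesis hx f = y := by
  obtain ⟨a, ha, hs⟩ := hy
  let f : lp (fun _ : ℕ => ℂ) p.conjExponent := ⟨a, memℓp_of_seqNorm_ne_top
    (one_le_conjExponent p) (ne_top_of_le_ne_top ENNReal.one_ne_top ha.1)⟩
  have hf : f ∈ coefSpace p.conjExponent :=
    mem_coefSpace fun h => ha.2 ((conjExponent_eq_top_iff hp.out).1 h)
  refine ⟨⟨f, hf⟩, ?_, (hasSum_synthesis hx ⟨f, hf⟩).unique hs⟩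
  have h1 : ‖f‖ₑ ≤ 1 := (seqNorm_lp f).symm.le.trans ha.1
  rwa [← ofReal_norm, ENNReal.ofReal_le_one] at h1

/-- A separable Banach space and an injective operator whose closed unit ball image is, up to an
arbitrarily small dilation, the given `p`-convex hull. -/
theorem exists_injective_operator_pConv (hp : 1 ≤ p) {x : ℕ → F} (hx : weakSeqNorm p x ≠ ∞) :
    ∃ (G : Type u) (_ : NormedAddCommGroup G) (_ : NormedSpace ℂ G) (_ : CompleteSpace G)
      (_ : SecondCountableTopology G) (T : G →L[ℂ] F), Function.Injective T ∧
      (∀ y ∈ pConv p x, ∃ g, ‖g‖ ≤ 1 ∧ T g = y) ∧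
      ∀ ε > 0, ∀ g, ‖g‖ ≤ 1 → ∃ y ∈ pConv p x, T g = ((1 + ε : ℝ) : ℂ) • y := by
  have : Fact (1 ≤ p) := ⟨hp⟩
  let N := (synthesis hx).ker
  have hN : IsClosed (N : Set (coefSpace p.conjExponent)) := (synthesis hx).isClosed_ker
  let T₀ : (coefSpace p.conjExponent ⧸ N) →L[ℂ] F := N.liftQL (synthesis hx) le_rfl
  have hT₀ : ∀ f, T₀ (N.mkQ f) = synthesis hx f := fun f => by simp [T₀]
  have hinj : Function.Injective T₀ := by
    have : T₀.toLinearMap.ker = ⊥ := Submodule.ker_liftQ_eq_bot _ _ _ le_rfl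
    exact LinearMap.ker_eq_bot.1 this
  have hsc : SecondCountableTopology (coefSpace p.conjExponent ⧸ N) :=
    N.isOpenQuotientMap_mkQ.isQuotientMap.secondCountableTopology
      N.isOpenQuotientMap_mkQ.isOpenMap
  -- The quotient lives in universe `0`, whereas factorizations are required to pass through spaces
  -- in universe `u`.
  let e : ULift.{u} (coefSpace p.conjExponent ⧸ N) ≃ₗᵢ[ℂ] (coefSpace p.conjExponent ⧸ N) :=
    LinearIsometryEquiv.ulift ℂ _
  let I : NormedAddCommGroup (coefSpace p.conjExponent ⧸ N) :=
    Submodule.Quotient.normedAddCommGroup N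
  let J : NormedSpace ℂ (coefSpace p.conjExponent ⧸ N) := Submodule.Quotient.normedSpace N ℂ
  refine ⟨ULift.{u} (coefSpace p.conjExponent ⧸ N), ULift.normedAddCommGroup,
    @ULift.normedSpace ℂ _ _ I.toSeminormedAddCommGroup J,
    e.toIsometryEquiv.completeSpace, e.toHomeomorph.secondCountableTopology,
    T₀.comp e.toContinuousLinearEquiv.toContinuousLinearMap,
    hinj.comp e.injective, fun y hy => ?_, fun ε hε g hg => ?_⟩
  · obtain ⟨f, hf, rfl⟩ := exists_synthesis_eq hx hy
    refine ⟨e.symm (N.mkQ f), ?_, ?_⟩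
    · rw [e.symm.norm_map]
      exact (Submodule.Quotient.norm_mk_le N f).trans hf
    · simpa using hT₀ f
  -- The quotient norm is an infimum that need not be attained, which is the origin of the dilation
  -- by `1 + ε`.
  · obtain ⟨f, hf, hfn⟩ := Submodule.Quotient.norm_mk_lt (e g) hε
    rw [e.norm_map] at hfn
    have h1 : (0 : ℝ) < 1 + ε := by positivity
    have h1' : ((1 + ε : ℝ) : ℂ) ≠ 0 := by exact_mod_cast h1.ne'
    refine ⟨synthesis hx (((1 + ε : ℝ) : ℂ)⁻¹ • f), synthesis_mem_pConv hx ?_, ?_⟩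
    · rw [norm_smul, norm_inv, Complex.norm_real, Real.norm_of_nonneg h1.le, inv_mul_le_one₀ h1]
      linarith
    · rw [map_smul, smul_smul, mul_inv_cancel₀ h1', one_smul, ← hT₀]
      exact congrArg T₀ hf.symm

end Factor

/-! ### The measure of `p`-compactness -/

section Size

variable {X : Type u} [NormedAddCommGroup X] [NormedSpace ℂ X]
  {Y : Type w} [NormedAddCommGroup Y] [NormedSpace ℂ Y] {p : ℝ≥0∞} {i : Kind}

theorem compactSize_le {K : Set X} {x : ℕ → X} (hx : IsGenerating p x i) (hK : K ⊆ pConv p x) :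
    compactSize i p K ≤ genNorm p x i :=
  iInf₂_le x ⟨hx, hK⟩

theorem toReal_compactSize_le {K : Set X} {x : ℕ → X} (hx : IsGenerating p x i)
    (hK : K ⊆ pConv p x) {A : ℝ} (hA : 0 ≤ A) (hxA : genNorm p x i ≤ ENNReal.ofReal A) :
    (compactSize i p K).toReal ≤ A :=
  ENNReal.toReal_le_of_le_ofReal hA ((compactSize_le hx hK).trans hxA)

theorem IsRelCompact.compactSize_ne_top {K : Set X} (hK : IsRelCompact i p K) :
    compactSize i p K ≠ ∞ := by
  obtain ⟨x, hx, hKx⟩ := hK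
  exact ((compactSize_le hx hKx).trans_lt hx.genNorm_lt_top).ne

theorem IsRelCompact.exists_generating {K : Set X} (hK : IsRelCompact i p K) {A : ℝ}
    (hA : (compactSize i p K).toReal < A) :
    ∃ x : ℕ → X, IsGenerating p x i ∧ K ⊆ pConv p x ∧ genNorm p x i ≤ ENNReal.ofReal A := by
  have h : compactSize i p K < ENNReal.ofReal A :=
    (ENNReal.lt_ofReal_iff_toReal_lt hK.compactSize_ne_top).2 hA
  simp only [compactSize, iInf_lt_iff] at h
  obtain ⟨x, ⟨hx, hKx⟩, hlt⟩ := h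
  exact ⟨x, hx, hKx, hlt.le⟩

theorem le_mul_of_forall_gt {a b c : ℝ} (h : ∀ x > a, b ≤ c * x) : b ≤ c * a := by
  have ht : Tendsto (fun x => c * x) (𝓝[>] a) (𝓝 (c * a)) :=
    ((continuous_const_mul c).tendsto a).mono_left nhdsWithin_le_nhds
  exact ge_of_tendsto ht (eventually_mem_nhdsWithin.mono h)

theorem IsRelCompact.norm_le (hp : 1 ≤ p) {K : Set X} (hK : IsRelCompact i p K) {y : X}
    (hy : y ∈ K) : ‖y‖ ≤ (compactSize i p K).toReal := by
  refine le_of_forall_gt_imp_ge_of_dense fun A hA => ?_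
  obtain ⟨x, hx, hKx, hxA⟩ := hK.exists_generating hA
  have h := (enorm_le_of_mem_pConv hp (hKx hy) i).trans hxA
  rwa [← ofReal_norm, ENNReal.ofReal_le_ofReal_iff (ENNReal.toReal_nonneg.trans hA.le)] at h

/-- Sets contained in a bounded dilation of the image of a relatively compact set. -/
theorem IsRelCompact.of_forall_exists_smul (hp : 1 ≤ p) {L : Set X} (hL : IsRelCompact i p L)
    {K : Set Y} (S : X →L[ℂ] Y) {c : ℝ} (hc : 0 ≤ c)
    (hK : ∀ y ∈ K, ∃ z ∈ L, ∃ t : ℂ, ‖t‖ ≤ c ∧ y = t • S z) :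
    IsRelCompact i p K ∧
      (compactSize i p K).toReal ≤ ‖S‖ * (compactSize i p L).toReal * c := by
  have key : ∀ x : ℕ → X, L ⊆ pConv p x → K ⊆ pConv p fun n => ((c : ℂ) • S) (x n) := by
    intro x hx y hy
    obtain ⟨z, hz, t, ht, rfl⟩ := hK y hy
    -- For `c = 0` the quotient `t / c` is not available, but then `t = 0` and the point is the
    -- origin.
    rcases hc.eq_or_lt with rfl | hc'
    · obtain rfl : t = 0 := norm_le_zero_iff.1 ht
      rw [zero_smul]
      exact zero_mem_pConv _
    · have hc0 : (c : ℂ) ≠ 0 := by exact_mod_cast hc'.ne'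
      have h1 : t • S z = (t / c) • ((c : ℂ) • S) z := by
        rw [smul_apply, smul_smul, div_mul_cancel₀ _ hc0]
      rw [h1]
      refine smul_mem_pConv (clm_mem_pConv _ (hx hz)) ?_
      rw [norm_div, Complex.norm_real, Real.norm_of_nonneg hc]
      exact div_le_one_of_le₀ ht hc
  refine ⟨?_, ?_⟩
  · obtain ⟨x, hx, hLx⟩ := hL
    exact ⟨_, hx.clm hp _, key x hLx⟩
  · rw [mul_right_comm]
    refine le_mul_of_forall_gt fun A hA => ?_
    have hA0 : 0 ≤ A := ENNReal.toReal_nonneg.trans hA.le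
    obtain ⟨x, hx, hLx, hxA⟩ := hL.exists_generating hA
    refine toReal_compactSize_le (hx.clm hp _) (key x hLx) (by positivity)
      ((genNorm_clm_le hp _ x i).trans ?_)
    rw [ENNReal.ofReal_mul (by positivity)]
    gcongr
    rw [← ofReal_norm, norm_smul, Complex.norm_real, Real.norm_of_nonneg hc, mul_comm]

theorem lpE_zero {ι : Type*} (hp : 1 ≤ p) : lpE p (fun _ : ι => 0) = 0 := by
  simpa using lpE_const_mul hp 0 (fun _ : ι => (0 : ℝ≥0∞))

theorem weakSeqNorm_zero (hp : 1 ≤ p) : weakSeqNorm p (fun _ => (0 : X)) = 0 :=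
  le_antisymm (weakSeqNorm_le fun φ _ => by simp [lpE_zero hp]) zero_le

theorem seqNorm_single_le {Z : Type*} [NormedAddCommGroup Z] (hp : 1 ≤ p) (y : Z) :
    seqNorm p (Pi.single 0 y : ℕ → Z) ≤ ‖y‖ₑ := by
  refine (lpE_le_tsum hp _).trans (le_of_eq ?_)
  rw [tsum_eq_single 0 fun n hn => by simp [hn]]
  simp

theorem genNorm_single_le (hp : 1 ≤ p) (y : X) (i : Kind) :
    genNorm p (Pi.single 0 y : ℕ → X) i ≤ ‖y‖ₑ := by
  cases i
  · exact seqNorm_single_le hp y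
  all_goals
    unfold genNorm
    split_ifs
    · exact seqNorm_single_le le_top y
    · exact (weakSeqNorm_le_seqNorm _ _).trans (seqNorm_single_le hp y)

theorem tendsto_single {Z : Type*} [NormedAddCommGroup Z] (y : Z) :
    Tendsto (Pi.single 0 y : ℕ → Z) atTop (𝓝 0) := by
  refine tendsto_const_nhds.congr' ?_
  filter_upwards [eventually_gt_atTop 0] with n hn
  simp [hn.ne']

theorem isGenerating_single (hp : 1 ≤ p) (y : X) (i : Kind) :
    IsGenerating p (Pi.single 0 y : ℕ → X) i := by
  have hs : seqNorm p (Pi.single 0 y : ℕ → X) < ∞ :=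
    (seqNorm_single_le hp y).trans_lt enorm_lt_top
  cases i <;> unfold IsGenerating <;> split_ifs with hpt
  · exact tendsto_single y
  · exact hs
  · intro φ
    have := (φ.continuous.tendsto 0).comp (tendsto_single y)
    simpa [Function.comp_def] using this
  · exact (weakSeqNorm_le_seqNorm _ _).trans_lt hs
  · exact tendsto_single y
  · refine ⟨(weakSeqNorm_le_seqNorm _ _).trans_lt hs, tendsto_const_nhds.congr' ?_⟩
    filter_upwards [eventually_gt_atTop 0] with m hm
    rw [← weakSeqNorm_zero (X := X) hp]
    congr 1
    ext n
    simp [hm.ne']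

theorem isRelCompact_singleton (hp : 1 ≤ p) (y : X) (i : Kind) :
    IsRelCompact i p {y} ∧ (compactSize i p {y}).toReal ≤ ‖y‖ := by
  have hsub : ({y} : Set X) ⊆ pConv p (Pi.single 0 y : ℕ → X) := by
    rintro _ rfl
    refine ⟨Pi.single 0 1, ⟨?_, fun _ => tendsto_single 1⟩, ?_⟩
    · exact (seqNorm_single_le (one_le_conjExponent p) (1 : ℂ)).trans (by simp)
    · convert hasSum_single 0 fun n hn => ?_ using 1
      · simp
      · simp [hn]
  refine ⟨⟨_, isGenerating_single hp y i, hsub⟩,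
    toReal_compactSize_le (isGenerating_single hp y i) hsub (norm_nonneg y) ?_⟩
  rw [ofReal_norm]
  exact genNorm_single_le hp y i

end Size

/-! ### Weighted holomorphic mappings -/

section WeightedMaps

variable {E : Type u} [NormedAddCommGroup E] {U : Opens E}
  {F : Type w} [NormedAddCommGroup F]

theorem wNorm_nonneg (v : Weight U) (f : U → F) : 0 ≤ wNorm v f :=
  Real.iSup_nonneg fun x => mul_nonneg (v.pos x).le (norm_nonneg _)

/-- The sign of `C` matters when `U` is empty, where the real supremum is `0`. -/
theorem wNorm_le {v : Weight U} {f : U → F} {C : ℝ} (hC : 0 ≤ C)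
    (h : ∀ x, v.toFun x * ‖f x‖ ≤ C) : wNorm v f ≤ C :=
  Real.iSup_le h hC

theorem norm_weight_smul [NormedSpace ℂ F] (v : Weight U) (f : U → F) (x : U) :
    ‖(v.toFun x : ℂ) • f x‖ = v.toFun x * ‖f x‖ := by
  rw [norm_smul, Complex.norm_real, Real.norm_of_nonneg (v.pos x).le]

variable [NormedSpace ℂ E] [NormedSpace ℂ F]

theorem mul_norm_le_wNorm {v : Weight U} {f : U → F} (hf : f ∈ weightedHol v F) (x : U) :
    v.toFun x * ‖f x‖ ≤ wNorm v f :=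
  le_ciSup hf.2 x

theorem weightedHol_intro {v : Weight U} {f : U → F} (hf : IsHolomorphic f) {C : ℝ}
    (hC : ∀ x, v.toFun x * ‖f x‖ ≤ C) : f ∈ weightedHol v F :=
  ⟨hf, C, by rintro _ ⟨x, rfl⟩; exact hC x⟩

theorem weightedHol_add {v : Weight U} {f g : U → F} (hf : f ∈ weightedHol v F)
    (hg : g ∈ weightedHol v F) : f + g ∈ weightedHol v F := by
  refine weightedHol_intro ?_ (C := wNorm v f + wNorm v g) fun x => ?_
  · obtain ⟨f', hf', hff⟩ := hf.1
    obtain ⟨g', hg', hgg⟩ := hg.1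
    exact ⟨f' + g', hf'.add hg', fun x => by simp [hff, hgg]⟩
  · calc v.toFun x * ‖(f + g) x‖ ≤ v.toFun x * (‖f x‖ + ‖g x‖) :=
          mul_le_mul_of_nonneg_left (norm_add_le _ _) (v.pos x).le
      _ = v.toFun x * ‖f x‖ + v.toFun x * ‖g x‖ := mul_add _ _ _
      _ ≤ _ := add_le_add (mul_norm_le_wNorm hf x) (mul_norm_le_wNorm hg x)

theorem weightedHol_smul {v : Weight U} {f : U → F} (c : ℂ) (hf : f ∈ weightedHol v F) :
    c • f ∈ weightedHol v F := by
  refine weightedHol_intro ?_ (C := ‖c‖ * wNorm v f) fun x => ?_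
  · obtain ⟨f', hf', hff⟩ := hf.1
    exact ⟨c • f', hf'.const_smul c, fun x => by simp [hff]⟩
  · rw [Pi.smul_apply, norm_smul, mul_left_comm]
    exact mul_le_mul_of_nonneg_left (mul_norm_le_wNorm hf x) (norm_nonneg c)

theorem weightedHol_smul_const {v : Weight U} {h : U → ℂ} (hh : h ∈ weightedHol v ℂ) (y : F) :
    (fun x => h x • y) ∈ weightedHol v F := by
  refine weightedHol_intro ?_ (C := wNorm v h * ‖y‖) fun x => ?_
  · obtain ⟨h', hh', hhh⟩ := hh.1
    exact ⟨fun x => h' x • y, hh'.smul_const y, fun x => by simp [hhh]⟩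
  · rw [norm_smul, ← mul_assoc]
    exact mul_le_mul_of_nonneg_right (mul_norm_le_wNorm hh x) (norm_nonneg y)

end WeightedMaps

/-! ### The Banach spaces of mappings with relatively compact weighted range -/

section Range

variable {E : Type u} [NormedAddCommGroup E] {U : Opens E} {v : Weight U}
  {F : Type w} [NormedAddCommGroup F] [NormedSpace ℂ F] {p : ℝ≥0∞} {i : Kind}

theorem mul_norm_le_compactSize (hp : 1 ≤ p) {f : U → F} (hf : IsRelCompact i p (vRange v f))
    (x : U) : v.toFun x * ‖f x‖ ≤ (compactSize i p (vRange v f)).toReal := by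
  rw [← norm_weight_smul]
  exact hf.norm_le hp ⟨x, rfl⟩

theorem wNorm_le_compactSize (hp : 1 ≤ p) {f : U → F} (hf : IsRelCompact i p (vRange v f)) :
    wNorm v f ≤ (compactSize i p (vRange v f)).toReal :=
  wNorm_le ENNReal.toReal_nonneg (mul_norm_le_compactSize hp hf)

theorem isRelCompact_vRange_smul (hp : 1 ≤ p) {f : U → F} (hf : IsRelCompact i p (vRange v f))
    (c : ℂ) : IsRelCompact i p (vRange v (c • f)) ∧
      (compactSize i p (vRange v (c • f))).toReal ≤
        ‖c‖ * (compactSize i p (vRange v f)).toReal := by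
  obtain ⟨h1, h2⟩ := hf.of_forall_exists_smul hp (K := vRange v (c • f))
    (ContinuousLinearMap.id ℂ F) (norm_nonneg c) (by
      rintro _ ⟨x, rfl⟩
      exact ⟨_, ⟨x, rfl⟩, c, le_rfl, by simp [smul_comm c]⟩)
  refine ⟨h1, h2.trans ?_⟩
  rw [mul_comm]
  gcongr
  exact mul_le_of_le_one_left ENNReal.toReal_nonneg ContinuousLinearMap.norm_id_le

theorem isRelCompact_vRange_zero (hp : 1 ≤ p) (v : Weight U) (i : Kind) :
    IsRelCompact i p (vRange v (0 : U → F)) ∧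
      (compactSize i p (vRange v (0 : U → F))).toReal = 0 := by
  obtain ⟨h1, h2⟩ := isRelCompact_singleton hp (0 : F) i
  obtain ⟨h3, h4⟩ := h1.of_forall_exists_smul hp (K := vRange v (0 : U → F))
    (ContinuousLinearMap.id ℂ F) le_rfl (by
      rintro _ ⟨x, rfl⟩
      exact ⟨0, rfl, 0, by simp, by simp⟩)
  exact ⟨h3, le_antisymm (by simpa using h4) ENNReal.toReal_nonneg⟩

theorem isRelCompact_vRange_add [CompleteSpace F] (hp : 1 ≤ p) {f g : U → F}
    (hf : IsRelCompact i p (vRange v f)) (hg : IsRelCompact i p (vRange v g)) :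
    IsRelCompact i p (vRange v (f + g)) ∧
      (compactSize i p (vRange v (f + g))).toReal ≤
        (compactSize i p (vRange v f)).toReal + (compactSize i p (vRange v g)).toReal := by
  have key : ∀ ε > 0, ∃ z : ℕ → F, IsGenerating p z i ∧ vRange v (f + g) ⊆ pConv p z ∧
      genNorm p z i ≤ ENNReal.ofReal ((compactSize i p (vRange v f)).toReal +
        (compactSize i p (vRange v g)).toReal + ε) := by
    intro ε hε
    obtain ⟨x, hx, hfx, hxA⟩ := hf.exists_generating (lt_add_of_pos_right _ (half_pos hε))
    obtain ⟨y, hy, hgy, hyB⟩ := hg.exists_generating (lt_add_of_pos_right _ (half_pos hε))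
    obtain ⟨z, hz, hzn, hzadd⟩ := exists_generating_add hp hx hy
      (add_pos_of_nonneg_of_pos ENNReal.toReal_nonneg (half_pos hε))
      (add_pos_of_nonneg_of_pos ENNReal.toReal_nonneg (half_pos hε)) hxA hyB
    refine ⟨z, hz, ?_, hzn.trans (ENNReal.ofReal_le_ofReal (by linarith))⟩
    rintro _ ⟨u, rfl⟩
    simp only [Pi.add_apply, smul_add]
    exact hzadd _ (hfx ⟨u, rfl⟩) _ (hgy ⟨u, rfl⟩)
  refine ⟨?_, le_of_forall_pos_le_add fun ε hε => ?_⟩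
  · obtain ⟨z, hz, hsub, -⟩ := key 1 one_pos
    exact ⟨z, hz, hsub⟩
  · obtain ⟨z, hz, hsub, hn⟩ := key ε hε
    exact toReal_compactSize_le hz hsub
      (add_nonneg (add_nonneg ENNReal.toReal_nonneg ENNReal.toReal_nonneg) hε.le) hn

/-- A telescoping series with rapidly decreasing differences converges in the measure of
compactness. -/
theorem isRelCompact_vRange_sub_lim [CompleteSpace F] (hp : 1 ≤ p) {t : ℕ → U → F} {f : U → F}
    {δ : ℝ} (hδ : 0 < δ) (ht : ∀ k, IsRelCompact i p (vRange v (t k - t (k + 1))))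
    (htn : ∀ k, (compactSize i p (vRange v (t k - t (k + 1)))).toReal < δ * (1 / 4) ^ (k + 1))
    (hlim : ∀ x, Tendsto (fun k => t k x) atTop (𝓝 (f x))) :
    IsRelCompact i p (vRange v (t 0 - f)) ∧
      (compactSize i p (vRange v (t 0 - f))).toReal ≤ δ := by
  choose x hx hsub hn using fun k => (ht k).exists_generating (htn k)
  -- The decay `δ / 4 ^ (k + 1)` absorbs the weight `2 ^ (k + 1)` and leaves a geometric series with
  -- sum `δ`.
  have hsum : ∑' k, 2 ^ (k + 1) * genNorm p (x k) i ≤ ENNReal.ofReal δ := by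
    have hg := hasSum_geometric_two' δ
    rw [← hg.tsum_eq, ENNReal.ofReal_tsum_of_nonneg (fun k => by positivity) hg.summable]
    refine ENNReal.tsum_le_tsum fun k => ?_
    have h2 : (2 : ℝ≥0∞) ^ (k + 1) = ENNReal.ofReal (2 ^ (k + 1)) := by
      rw [ENNReal.ofReal_pow zero_le_two]
      simp
    calc 2 ^ (k + 1) * genNorm p (x k) i
        ≤ ENNReal.ofReal (2 ^ (k + 1)) * ENNReal.ofReal (δ * (1 / 4) ^ (k + 1)) := by
          rw [h2]
          gcongr
          exact hn k
      _ = ENNReal.ofReal (δ / 2 / 2 ^ k) := by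
          rw [← ENNReal.ofReal_mul (by positivity)]
          congr 1
          rw [mul_left_comm, ← mul_pow]
          rw [show (2 : ℝ) * (1 / 4) = 2⁻¹ by norm_num, inv_pow, pow_succ]
          field_simp
  obtain ⟨z, hz, hzn, hzs⟩ := exists_generating_tsum hp hx ENNReal.ofReal_ne_top hsum
  have hK : vRange v (t 0 - f) ⊆ pConv p z := by
    rintro _ ⟨u, rfl⟩
    obtain ⟨Y, hY, hYs⟩ := hzs (fun k => (v.toFun u : ℂ) • (t k - t (k + 1)) u)
      fun k => hsub k ⟨u, rfl⟩
    have h1 := hYs.tendsto_sum_nat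
    have h2 : ∀ n, ∑ k ∈ Finset.range n, (v.toFun u : ℂ) • (t k - t (k + 1)) u =
        (v.toFun u : ℂ) • (t 0 u - t n u) := fun n => by
      rw [← Finset.smul_sum]
      congr 1
      exact Finset.sum_range_sub' (fun k => t k u) n
    simp_rw [h2] at h1
    have h3 := tendsto_nhds_unique h1 ((tendsto_const_nhds.sub (hlim u)).const_smul _)
    rw [h3] at hY
    exact hY
  exact ⟨⟨z, hz, hK⟩, toReal_compactSize_le hz hK hδ.le hzn⟩

end Range

section Banach

variable {E : Type u} [NormedAddCommGroup E] [NormedSpace ℂ E] {U : Opens E} {v : Weight U}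
  {F : Type u} [NormedAddCommGroup F] [NormedSpace ℂ F] {p : ℝ≥0∞} {i : Kind}

/-- The mappings in `H_v^∞(U, F)` with relatively compact weighted range. -/
def rangeSpace (i : Kind) (p : ℝ≥0∞) (v : Weight U) (F : Type u) [NormedAddCommGroup F]
    [NormedSpace ℂ F] : Set (U → F) :=
  {f | f ∈ weightedHol v F ∧ IsRelCompact i p (vRange v f)}

theorem rangeSpace_add [CompleteSpace F] (hp : 1 ≤ p) {f g : U → F} (hf : f ∈ rangeSpace i p v F)
    (hg : g ∈ rangeSpace i p v F) : f + g ∈ rangeSpace i p v F :=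
  ⟨weightedHol_add hf.1 hg.1, (isRelCompact_vRange_add hp hf.2 hg.2).1⟩

theorem rangeSpace_smul (hp : 1 ≤ p) {f : U → F} (c : ℂ) (hf : f ∈ rangeSpace i p v F) :
    c • f ∈ rangeSpace i p v F :=
  ⟨weightedHol_smul c hf.1, (isRelCompact_vRange_smul hp hf.2 c).1⟩

theorem rangeSpace_sub [CompleteSpace F] (hp : 1 ≤ p) {f g : U → F} (hf : f ∈ rangeSpace i p v F)
    (hg : g ∈ rangeSpace i p v F) : f - g ∈ rangeSpace i p v F := by
  have h := rangeSpace_add hp hf (rangeSpace_smul hp (-1) hg)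
  rwa [neg_one_smul, ← sub_eq_add_neg] at h

/-- The measure dominates the weighted norm, so a holomorphic limit `f` exists. Telescoping along a
fast subsequence that starts at `s n` bounds the measure of `s n - f`; membership of `f` follows
from `f = s n - (s n - f)`. -/
theorem exists_tendsto_rangeSpace [CompleteSpace F] (hp : 1 ≤ p) {s : ℕ → U → F}
    (hs : ∀ n, s n ∈ rangeSpace i p v F)
    (hcau : ∀ ε > 0, ∃ n₀, ∀ m ≥ n₀, ∀ n ≥ n₀,
      (compactSize i p (vRange v (s m - s n))).toReal < ε) :
    ∃ f ∈ rangeSpace i p v F,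
      Tendsto (fun n => (compactSize i p (vRange v (s n - f))).toReal) atTop (𝓝 0) := by
  have hsub : ∀ m n, s m - s n ∈ rangeSpace i p v F := fun m n => rangeSpace_sub hp (hs m) (hs n)
  have hcau' : ∀ ε > 0, ∃ N, ∀ m ≥ N, ∀ n ≥ N, ∀ x, v.toFun x * ‖s m x - s n x‖ ≤ ε :=
    fun ε hε => by
      obtain ⟨N, hN⟩ := hcau ε hε
      exact ⟨N, fun m hm n hn x =>
        (mul_norm_le_compactSize hp (hsub m n).2 x).trans (hN m hm n hn).le⟩
  have hlim : ∀ x, ∃ y, Tendsto (fun n => s n x) atTop (𝓝 y) := fun x => by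
    refine cauchySeq_tendsto_of_complete (Metric.cauchySeq_iff.2 fun ε hε => ?_)
    obtain ⟨N, hN⟩ := hcau' (v.toFun x * (ε / 2)) (mul_pos (v.pos x) (half_pos hε))
    refine ⟨N, fun m hm n hn => ?_⟩
    rw [dist_eq_norm]
    exact (le_of_mul_le_mul_left (hN m hm n hn x) (v.pos x)).trans_lt (half_lt_self hε)
  choose f hf using hlim
  have hfhol : f ∈ weightedHol v F := by
    obtain ⟨N, hN⟩ := hcau' 1 one_pos
    refine weightedHol_intro (IsHolomorphic.of_tendsto v (fun n => (hs n).1.1) hf hcau')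
      (C := 1 + wNorm v (s N)) fun x => ?_
    have h1 : v.toFun x * ‖f x - s N x‖ ≤ 1 :=
      le_of_tendsto ((((hf x).sub_const (s N x)).norm).const_mul (v.toFun x))
        ((eventually_ge_atTop N).mono fun n hn => hN n hn N le_rfl x)
    calc v.toFun x * ‖f x‖ ≤ v.toFun x * (‖f x - s N x‖ + ‖s N x‖) := by
          refine mul_le_mul_of_nonneg_left ?_ (v.pos x).le
          simpa using norm_add_le (f x - s N x) (s N x)
      _ = v.toFun x * ‖f x - s N x‖ + v.toFun x * ‖s N x‖ := mul_add _ _ _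
      _ ≤ _ := add_le_add h1 (mul_norm_le_wNorm (hs N).1 x)
  have key : ∀ δ > 0, ∃ n₀, ∀ n ≥ n₀, IsRelCompact i p (vRange v (s n - f)) ∧
      (compactSize i p (vRange v (s n - f))).toReal ≤ δ := by
    intro δ hδ
    choose M hM using fun k : ℕ => hcau (δ * (1 / 4) ^ (k + 1)) (by positivity)
    refine ⟨M 0, fun n hn => ?_⟩
    let φ : ℕ → ℕ := fun k => k + ∑ j ∈ Finset.range (k + 1), M j
    have hφ : ∀ k, ∀ j ≤ k, M j ≤ φ k := fun k j hj =>
      (Finset.single_le_sum (f := M) (fun _ _ => Nat.zero_le _)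
        (Finset.mem_range.2 (Nat.lt_succ_of_le hj))).trans (Nat.le_add_left _ _)
    -- The subsequence starts at the given `n` and then follows `φ`. Since `φ k` dominates every `M
    -- j` with `j ≤ k`, both `τ k` and `τ (k + 1)` are at least `M k`.
    let τ : ℕ → ℕ := fun k => if k = 0 then n else φ k
    have hτ : ∀ k, M k ≤ τ k := fun k => by
      by_cases hk : k = 0
      · simpa [τ, hk] using hn
      · simpa [τ, hk] using hφ k k le_rfl
    have hτ' : ∀ k, M k ≤ τ (k + 1) := fun k => by
      simpa [τ] using hφ (k + 1) k (Nat.le_succ k)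
    have hτlim : Tendsto τ atTop atTop := by
      refine tendsto_atTop_mono' atTop ?_ tendsto_id
      filter_upwards [eventually_gt_atTop 0] with k hk
      simp only [τ, hk.ne', if_false, φ, id]
      exact Nat.le_add_right _ _
    exact isRelCompact_vRange_sub_lim hp (t := fun k => s (τ k)) hδ (fun k => (hsub _ _).2)
      (fun k => hM k _ (hτ k) _ (hτ' k)) fun x => (hf x).comp hτlim
  obtain ⟨n₁, hn₁⟩ := key 1 one_pos
  have hneg : (-1 : ℂ) • f ∈ weightedHol v F := weightedHol_smul _ hfhol
  have hfmem : f ∈ rangeSpace i p v F := by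
    have h1 : s n₁ - f ∈ rangeSpace i p v F := by
      refine ⟨?_, (hn₁ n₁ le_rfl).1⟩
      rw [sub_eq_add_neg, ← neg_one_smul ℂ f]
      exact weightedHol_add (hs n₁).1 hneg
    simpa using rangeSpace_sub hp (hs n₁) h1
  refine ⟨f, hfmem, Metric.tendsto_atTop.2 fun ε hε => ?_⟩
  obtain ⟨n₀, hn₀⟩ := key (ε / 2) (half_pos hε)
  refine ⟨n₀, fun n hn => ?_⟩
  rw [Real.dist_0_eq_abs, abs_of_nonneg ENNReal.toReal_nonneg]
  exact (hn₀ n hn).2.trans_lt (half_lt_self hε)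

theorem isBanachSubspace_rangeSpace [CompleteSpace F] (hp : 1 ≤ p) (v : Weight U) (i : Kind) :
    IsBanachSubspace (rangeSpace i p v F) fun f => (compactSize i p (vRange v f)).toReal where
  zero_mem := ⟨weightedHol_intro (C := 0) ⟨0, differentiableOn_const 0, fun _ => rfl⟩
    (by simp), (isRelCompact_vRange_zero hp v i).1⟩
  add_mem _ hf _ hg := rangeSpace_add hp hf hg
  smul_mem c _ hf := rangeSpace_smul hp c hf
  norm_nonneg _ _ := ENNReal.toReal_nonneg
  norm_eq_zero_iff f hf := by
    refine ⟨fun h => funext fun x => ?_, ?_⟩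
    · have h1 := mul_norm_le_compactSize hp hf.2 x
      rw [h] at h1
      exact norm_le_zero_iff.1 (nonpos_of_mul_nonpos_right h1 (v.pos x))
    · rintro rfl
      exact (isRelCompact_vRange_zero hp v i).2
  norm_smul c f hf := by
    refine le_antisymm (isRelCompact_vRange_smul hp hf.2 c).2 ?_
    by_cases hc : c = 0
    · simp [hc]
    · have h := (isRelCompact_vRange_smul hp (rangeSpace_smul hp c hf).2 c⁻¹).2
      rwa [smul_smul, inv_mul_cancel₀ hc, one_smul, norm_inv, le_inv_mul_iff₀
        (norm_pos_iff.2 hc)] at h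
  norm_add_le _ hf _ hg := (isRelCompact_vRange_add hp hf.2 hg.2).2
  complete _ hs hcau := exists_tendsto_rangeSpace hp hs hcau

/-! ### Factorization through compact operators -/

/-- The values of `v f` are lifted through the injective operator to the unit ball of `G` and then
divided by `v`. Injectivity and separability of `G` make the lift holomorphic. -/
theorem exists_factorization [CompleteSpace F] (hp : 1 ≤ p) {f : U → F} (hf : f ∈ rangeSpace i p v F) {A : ℝ}
    (hA : (compactSize i p (vRange v f)).toReal < A) :
    ∃ (G : Type u) (_ : NormedAddCommGroup G) (_ : NormedSpace ℂ G) (_ : CompleteSpace G)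
      (T : G →L[ℂ] F) (g : U → G),
      T ∈ (compactOperators i p).mem G F ∧ g ∈ weightedHol v G ∧ (∀ x, f x = T (g x)) ∧
      (compactOperators i p).norm T * wNorm v g ≤ A := by
  obtain ⟨B, hB, hBA⟩ := exists_between hA
  have hB0 : 0 ≤ B := ENNReal.toReal_nonneg.trans hB.le
  have hA0 : 0 < A := hB0.trans_lt hBA
  obtain ⟨x, hx, hfx, hxB⟩ := hf.2.exists_generating hB
  obtain ⟨G, _, _, _, _, T, hT, hlift, hball⟩ := exists_injective_operator_pConv hp
    ((weakSeqNorm_le_genNorm p x i).trans_lt hx.genNorm_lt_top).ne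
  obtain ⟨ε, hε, hεA⟩ : ∃ ε > 0, (1 + ε) * B ≤ A := by
    -- The denominator `B + 1` avoids division by zero when `B = 0`.
    refine ⟨(A - B) / (B + 1), div_pos (by linarith) (by linarith), ?_⟩
    have h1 : (A - B) / (B + 1) * B ≤ A - B := by
      rw [div_mul_eq_mul_div, div_le_iff₀ (by linarith)]
      nlinarith
    linarith
  choose g₀ hg₀ hTg₀ using fun u : U => hlift _ (hfx ⟨u, rfl⟩)
  let g : U → G := fun u => ((v.toFun u : ℂ))⁻¹ • g₀ u
  have hTg : ∀ u, T (g u) = f u := fun u => by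
    have h0 : (v.toFun u : ℂ) ≠ 0 := by exact_mod_cast (v.pos u).ne'
    simp only [g, map_smul, hTg₀, smul_smul, inv_mul_cancel₀ h0, one_smul]
  have hg1 : ∀ u, v.toFun u * ‖g u‖ ≤ 1 := fun u => by
    simp only [g]
    rw [norm_smul, norm_inv, Complex.norm_real, Real.norm_of_nonneg (v.pos u).le,
      mul_inv_cancel_left₀ (v.pos u).ne']
    exact hg₀ u
  have hghol : g ∈ weightedHol v G :=
    weightedHol_intro (IsHolomorphic.of_injective hT v hf.1.1 hTg hg1) hg1
  let S : F →L[ℂ] F := ((1 + ε : ℝ) : ℂ) • ContinuousLinearMap.id ℂ F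
  have hTball : T '' Metric.closedBall (0 : G) 1 ⊆ pConv p fun n => S (x n) := by
    rintro _ ⟨y, hy, rfl⟩
    obtain ⟨z, hz, hyz⟩ := hball ε hε y (mem_closedBall_zero_iff.1 hy)
    have := clm_mem_pConv S hz
    rw [hyz]
    exact this
  have hSn : ‖S‖ ≤ 1 + ε := by
    have h1 : ‖((1 + ε : ℝ) : ℂ)‖ = 1 + ε := by
      rw [Complex.norm_real, Real.norm_of_nonneg (by linarith)]
    calc ‖S‖ ≤ ‖((1 + ε : ℝ) : ℂ)‖ * ‖ContinuousLinearMap.id ℂ F‖ := (norm_smul _ _).le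
      _ ≤ (1 + ε) * 1 := by
        rw [h1]
        exact mul_le_mul_of_nonneg_left ContinuousLinearMap.norm_id_le (by linarith)
      _ = 1 + ε := mul_one _
  have hTn : (compactOperators i p).norm T ≤ A := by
    refine toReal_compactSize_le (hx.clm hp S) hTball hA0.le
      ((genNorm_clm_le hp S x i).trans ?_)
    rw [← ofReal_norm]
    calc ENNReal.ofReal ‖S‖ * genNorm p x i
        ≤ ENNReal.ofReal (1 + ε) * ENNReal.ofReal B := by gcongr
      _ = ENNReal.ofReal ((1 + ε) * B) := (ENNReal.ofReal_mul (by linarith)).symm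
      _ ≤ _ := ENNReal.ofReal_le_ofReal hεA
  refine ⟨G, inferInstance, inferInstance, inferInstance, T, g, ⟨_, hx.clm hp S, hTball⟩, hghol,
    fun u => (hTg u).symm, ?_⟩
  calc (compactOperators i p).norm T * wNorm v g ≤ A * 1 :=
        mul_le_mul hTn (wNorm_le zero_le_one hg1) (wNorm_nonneg _ _) hA0.le
    _ = A := mul_one A

/-- Each `v x • f x` is `‖g‖_v` times the image under `T` of `v x • g x / ‖g‖_v`, a point of the
unit ball. If `‖g‖_v = 0`, then `g` vanishes and is treated separately. -/
theorem isRelCompact_vRange_of_factorization (hp : 1 ≤ p) {G : Type u} [NormedAddCommGroup G]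
    [NormedSpace ℂ G] {T : G →L[ℂ] F} (hT : IsRelCompact i p (T '' Metric.closedBall (0 : G) 1))
    {g : U → G} (hg : g ∈ weightedHol v G) {f : U → F} (hf : ∀ x, f x = T (g x)) :
    IsRelCompact i p (vRange v f) ∧ (compactSize i p (vRange v f)).toReal ≤
      (compactSize i p (T '' Metric.closedBall (0 : G) 1)).toReal * wNorm v g := by
  obtain ⟨h1, h2⟩ := hT.of_forall_exists_smul hp (K := vRange v f)
    (ContinuousLinearMap.id ℂ F) (wNorm_nonneg v g) (by
      rintro _ ⟨x, rfl⟩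
      have hn := mul_norm_le_wNorm hg x
      rcases (wNorm_nonneg v g).eq_or_lt with h0 | h0
      · have hgx : g x = 0 := norm_le_zero_iff.1
          (nonpos_of_mul_nonpos_right (hn.trans h0.symm.le) (v.pos x))
        exact ⟨0, ⟨0, by simp, by simp⟩, 0, by simpa using h0.le, by simp [hf, hgx]⟩
      · have hc0 : (wNorm v g : ℂ) ≠ 0 := by exact_mod_cast h0.ne'
        refine ⟨_, ⟨(wNorm v g : ℂ)⁻¹ • (v.toFun x : ℂ) • g x, ?_, rfl⟩, wNorm v g, ?_, ?_⟩
        · rw [mem_closedBall_zero_iff, norm_smul, norm_weight_smul, norm_inv, Complex.norm_real,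
            Real.norm_of_nonneg h0.le, inv_mul_le_one₀ h0]
          exact hn
        · rw [Complex.norm_real, Real.norm_of_nonneg h0.le]
        · simp only [map_smul, ContinuousLinearMap.id_apply, smul_smul]
          rw [← mul_assoc, mul_inv_cancel₀ hc0, one_mul, hf])
  refine ⟨h1, h2.trans ?_⟩
  exact mul_le_mul_of_nonneg_right
    (mul_le_of_le_one_left ENNReal.toReal_nonneg ContinuousLinearMap.norm_id_le)
    (wNorm_nonneg v g)

end Banach

/-! ### The isometric identity and the ideal axioms -/

theorem isometricallyEqual_compositionClass (i : Kind) {p : ℝ≥0∞} (hp : 1 ≤ p) :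
    (compactRangeClass.{u} i p).IsometricallyEqual
      (compositionClass (compactOperators.{u} i p)) := by
  intro E _ _ _ U v F _ _ _
  refine ⟨Set.ext fun f => ⟨fun hf => ⟨hf.1, ?_⟩, ?_⟩, fun f hf => le_antisymm ?_ ?_⟩
  · obtain ⟨G, _, _, _, T, g, hT, hg, hfg, -⟩ := exists_factorization hp hf (lt_add_one _)
    exact ⟨G, inferInstance, inferInstance, inferInstance, T, g, hT, hg, hfg⟩
  · rintro ⟨hf, G, _, _, _, T, g, hT, hg, hfg⟩
    exact ⟨hf, (isRelCompact_vRange_of_factorization hp hT hg hfg).1⟩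
  · refine le_csInf ?_ ?_
    · obtain ⟨G, _, _, _, T, g, hT, hg, hfg, -⟩ := exists_factorization hp hf (lt_add_one _)
      exact ⟨_, G, inferInstance, inferInstance, inferInstance, T, g, hT, hg, hfg, rfl⟩
    · rintro _ ⟨G, _, _, _, T, g, hT, hg, hfg, rfl⟩
      exact (isRelCompact_vRange_of_factorization hp hT hg hfg).2
  · refine le_of_forall_gt_imp_ge_of_dense fun A hA => ?_
    obtain ⟨G, _, _, _, T, g, hT, hg, hfg, hle⟩ := exists_factorization hp hf hA
    refine (csInf_le ⟨0, ?_⟩ ?_).trans hle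
    · rintro _ ⟨G, _, _, _, T, g, hT, hg, hfg, rfl⟩
      exact mul_nonneg ENNReal.toReal_nonneg (wNorm_nonneg v g)
    · exact ⟨G, inferInstance, inferInstance, inferInstance, T, g, hT, hg, hfg, rfl⟩

theorem isBanachIdeal_compactRangeClass (i : Kind) {p : ℝ≥0∞} (hp : 1 ≤ p) :
    (compactRangeClass.{u} i p).IsBanachIdeal where
  subset_weightedHol v F _ _ _ _ hf := hf.1
  isBanach v F _ _ _ := isBanachSubspace_rangeSpace hp v i
  wNorm_le v F _ _ _ f hf := wNorm_le_compactSize hp hf.2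
  smul_const v F _ _ _ h hh y := by
    obtain ⟨h1, h2⟩ := isRelCompact_singleton hp y i
    obtain ⟨h3, h4⟩ := h1.of_forall_exists_smul hp (K := vRange v fun x => h x • y)
      (ContinuousLinearMap.id ℂ F) (wNorm_nonneg v h) (by
        rintro _ ⟨x, rfl⟩
        refine ⟨y, rfl, (v.toFun x : ℂ) • h x, ?_, by simp [mul_smul]⟩
        rw [norm_weight_smul]
        exact mul_norm_le_wNorm hh x)
    refine ⟨⟨weightedHol_smul_const hh y, h3⟩, le_antisymm (h4.trans ?_) ?_⟩
    · rw [mul_comm]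
      refine mul_le_mul_of_nonneg_left ?_ (wNorm_nonneg v h)
      exact (mul_le_of_le_one_left ENNReal.toReal_nonneg ContinuousLinearMap.norm_id_le).trans h2
    -- The lower bound holds because the measure dominates the weighted norm, which for `h · y` is
    -- `‖h‖_v * ‖y‖`.
    · refine le_trans (le_of_eq ?_) (wNorm_le_compactSize hp h3)
      simp only [wNorm, norm_smul, ← mul_assoc]
      exact Real.iSup_mul_of_nonneg (norm_nonneg y) _
  ideal {E} _ _ _ {U V} v hVU F G₀ _ _ _ _ _ _ h f S hh hbdd hf := by
    set c := ⨆ x : V, (v.restrict hVU).toFun x / v.toFun (h x) with hc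
    have hcx : ∀ x : V, (v.restrict hVU).toFun x / v.toFun (h x) ≤ c := fun x => le_ciSup hbdd x
    have hc0 : 0 ≤ c := Real.iSup_nonneg fun x => (div_pos (Weight.pos _ x) (v.pos _)).le
    -- The new weighted value is `v x / v (h x)` times the image under `S` of the point `v (h x) • f
    -- (h x)` of the old range.
    obtain ⟨h1, h2⟩ := hf.2.of_forall_exists_smul hp
      (K := vRange (v.restrict hVU) fun x => S (f (h x))) S hc0 (by
        rintro _ ⟨x, rfl⟩
        have hv0 : (v.toFun (h x) : ℂ) ≠ 0 := by exact_mod_cast (v.pos _).ne'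
        refine ⟨_, ⟨h x, rfl⟩, (((v.restrict hVU).toFun x / v.toFun (h x) : ℝ) : ℂ), ?_, ?_⟩
        · rw [Complex.norm_real, Real.norm_of_nonneg (div_pos (Weight.pos _ x) (v.pos _)).le]
          exact hcx x
        · rw [map_smul, smul_smul]
          push_cast
          rw [div_mul_cancel₀ _ hv0])
    refine ⟨⟨weightedHol_intro ?_ (mul_norm_le_compactSize hp h1), h1⟩, h2⟩
    obtain ⟨f', hf', hff⟩ := hf.1.1
    obtain ⟨h', hh', hhh⟩ := hh
    refine ⟨fun x => S (f' (h' x)), S.differentiable.comp_differentiableOn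
      (hf'.comp hh' fun x hx => ?_), fun x => congrArg S ((congrArg f' (hhh x)).trans (hff _))⟩
    exact (hhh ⟨x, hx⟩).symm ▸ (h ⟨x, hx⟩).2

end

end WeightedHol

theorem mainTheorem3 (i : WeightedHol.Kind) (p : ℝ≥0∞) (hp : 1 ≤ p) :
    (WeightedHol.compactRangeClass.{u} i p).IsometricallyEqual
        (WeightedHol.compositionClass (WeightedHol.compactOperators.{u} i p)) ∧
      (WeightedHol.compactRangeClass.{u} i p).IsBanachIdeal := by
  exact ⟨WeightedHol.isometricallyEqual_compositionClass i hp,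
    WeightedHol.isBanachIdeal_compactRangeClass i hp⟩
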